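/- Let $p\in(0,1]$ and let $F$ be a probability distribution on $(0,\infty)$ with finite second moment, i.e. $\mathbb{E}[v^2]<\infty$ for a random variable $v$ with distribution $F$. Consider the random directed graph with vertex set $\mathbb{Z}$ in which each edge $(i,j)$, $i<j$, is present independently with probability $p$, and carries a weight $v_{i,j}$, where the weights $v_{i,j}$ are i.i.d. with distribution $F$ and independent of the set of edges present. For $i\le j$ let $$w_{i,j}=\max_{\pi}\sum_{e\in\pi}v_e,$$ where the maximum is over all directed paths $\pi=((i_0,i_1),(i_1,i_2),\dots,(i_{l-1},i_l))$, $l\ge 0$, from $i=i_0$ to $j=i_l$ whose edges are all present, and $w_{i,j}=-\infty$ if there is no such path; write $w_{i,j}^+=\max(w_{i,j},0)$. Then there exists a constant $C\in(0,\infty)$, depending only on $p$ and $F$, such that $$\frac{w_{0,n}}{n}\xrightarrow[n\to\infty]{}C\quad\text{almost surely}$$ and $$\frac{w_{0,n}^+}{n}\xrightarrow[n\to\infty]{}C\quad\text{in }\mathcal{L}^1.$$ -/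

import Mathlib

open MeasureTheory ProbabilityTheory Filter Topology

namespace LongRangeLPP

/-- A directed edge `(i, j)` of the integer line, `i < j`. -/
abbrev Edge : Type := {e : ℤ × ℤ // e.1 < e.2}

/-- `IsPath E i j π`: the list `π = [(i₀, i₁), (i₁, i₂), …, (iₗ₋₁, iₗ)]` of edges of the graph with
vertex set `ℤ` and edge set `E` is an increasing path from `i = i₀` to `j = iₗ` (with `l ≥ 0`). -/
def IsPath (E : Set Edge) : ℤ → ℤ → List Edge → Prop
  | i, j, [] => i = j
  | i, j, e :: π => e ∈ E ∧ e.1.1 = i ∧ IsPath E e.1.2 j π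

/-- The weight of a path: the sum of the weights of its edges. -/
def pathWeight (v : Edge → ℝ) (π : List Edge) : ℝ := (π.map v).sum

/-- The maximal weight of a path from `i` to `j` in the graph with edge set `E`; it is
`⊥ = -∞` if there is no such path. (There are only finitely many increasing paths from `i` to
`j`, so that the supremum is a maximum, and is never `⊤`.) -/
noncomputable def passageTime (E : Set Edge) (v : Edge → ℝ) (i j : ℤ) : EReal :=
  ⨆ (π : List Edge) (_ : IsPath E i j π), (pathWeight v π : EReal)

/-- The random weighted graph on `ℤ`: the edge `e` is present when `α e = true`, which has
probability `p`; it carries the weight `v e`, which has law `F`; and all the random variables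
`α e`, `v e`, `e` an edge, are mutually independent. -/
structure IsModel {Ω : Type*} [MeasurableSpace Ω] (P : Measure Ω) (p : ℝ) (F : Measure ℝ)
    (α : Edge → Ω → Bool) (v : Edge → Ω → ℝ) : Prop where
  measurable_present : ∀ e, Measurable (α e)
  measurable_weight : ∀ e, Measurable (v e)
  prob_present : ∀ e, P {ω | α e ω = true} = ENNReal.ofReal p
  law_weight : ∀ e, P.map (v e) = F
  indep_present_weight : ∀ e, IndepFun (α e) (v e) P
  indep_edges : iIndepFun (fun e ω => (α e ω, v e ω)) P

/-- The passage time `w i j` of the random weighted graph. -/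
noncomputable def w {Ω : Type*} (α : Edge → Ω → Bool) (v : Edge → Ω → ℝ) (i j : ℤ) (ω : Ω) :
    EReal :=
  passageTime {e | α e ω = true} (fun e => v e ω) i j

/-- The positive part `max (w i j) 0` of the passage time, as a real number. -/
noncomputable def wPos {Ω : Type*} (α : Edge → Ω → Bool) (v : Edge → Ω → ℝ) (i j : ℤ) (ω : Ω) :
    ℝ :=
  (max (w α v i j ω) 0).toReal

end LongRangeLPP

/-!
Why the theorem holds. All the statements concern the joint law of presence and weights of the
edges, which for every model is the same product measure `cfgLaw p F`
(`IsModel.measurePreserving`); so everything is proved on the space `Cfg` of configurations, and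
the constant depends on `p` and `F` only. Let `W n = maxWt 0 n` be the maximal weight of a path in
`[0, n)` with free endpoints. The growth rate is `C = lim 𝔼[W n] / n`. No subadditive ergodic
theorem is used; independence of blocks does its work.

*Upper bound.* Cut `[0, k m)` into `k` blocks of length `m`. An edge `e` of a path that leads from
one block to another has weight at most `c` times its length plus its excess `(v e - c |e|)⁺`, and
the lengths add up to at most `k m`. Hence `W (k m) ≤ c k m + ∑ b, (W_b + R_b)`, where `W_b` is the
best path in the block `b` and `R_b` the sum of the excesses of all the edges that leave it
(`maxWt_le_sum_blockWt`). The summands are independent and identically distributed. By the second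
moment, `∑ l, 𝔼[(v - c l)⁺] < ∞`, and so `𝔼[R_b] / m → 0` as `m → ∞`, for every `c > 0`
(`tendsto_lintegral_exitExcess`). So `𝔼[W n] / n` converges (`exists_tendsto_meanWt`), and the
strong law of large numbers for the blocks gives `limsup W n / n ≤ C` almost surely
(`ae_eventually_maxWt_div_lt`) and `(W n / n - C)⁺ → 0` in `L¹`. As the means converge to `C`, it
follows that `W n / n → C` in `L¹` (`tendsto_integral_abs_maxWt`).

*Positivity.* The mean of the best weight of a path in `[0, n)` from `0` increases by at least
`p 𝔼[v]` from `n` to `n + 1`: use the edge `(0, 1)` if it is present, and skip the vertex `1`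
otherwise (`lintegral_maxFrom_succ`).

*Lower bound.* For `n` of order `g ^ 4`, take about `g ^ 2` intervals of length `g ^ 2` in `[0, n]`,
separated by gaps of length `g + 1`. By the convergence in `L¹` an interval is light, that is, has
no path of weight close to `C g ^ 2`, with a small probability, and so the probability that more
than a small fraction of the intervals is light is exponentially small (`cfgLaw_numLight_le`). With
a probability summably close to one, all pairs of vertices in `[0, n]` at distance more than `g` are
joined by a path of two edges (`ae_eventually_allLinked`). So by the Borel–Cantelli lemma heavy paths
in almost all the intervals are eventually joined to a path from `0` to `n`
(`ae_eventually_exists_isPath`). In particular the passage time is eventually finite.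

The convergence in `L¹` of the positive part of the passage time follows, as it is at most
`W (n + 1)`, and its negative deviations from `C n` are bounded by `C n`.
-/

namespace LongRangeLPP

open scoped ENNReal

/-! ### Product measures -/

/-- A measurable function of the coordinates in `U` is measurable for any σ-algebra that makes
these coordinates measurable. -/
lemma comap_le_of_dependsOn {ι : Type*} {X : ι → Type*} [∀ i, MeasurableSpace (X i)]
    {β : Type*} [MeasurableSpace β] {f : (∀ i, X i) → β} {U : Set ι} (x₀ : ∀ i, X i)
    (hf : Measurable f) (hU : DependsOn f U) (m : MeasurableSpace (∀ i, X i))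
    (hm : ∀ i ∈ U, MeasurableSpace.comap (fun ω : ∀ i, X i => ω i) inferInstance ≤ m) :
    MeasurableSpace.comap f inferInstance ≤ m := by
  classical
  -- Freeze the other coordinates at those of `x₀`.
  have h1 : f = f ∘ fun (ω : ∀ i, X i) i => if i ∈ U then ω i else x₀ i := by
    funext ω
    exact hU fun i hi => by simp [hi]
  rw [h1, ← MeasurableSpace.comap_comp]
  refine (MeasurableSpace.comap_mono hf.comap_le).trans ?_
  simp only [MeasurableSpace.pi, MeasurableSpace.comap_iSup, MeasurableSpace.comap_comp]
  refine iSup_le fun i => ?_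
  by_cases hi : i ∈ U
  · convert! hm i hi using 2
    funext ω
    simp [hi]
  · have : ((fun b : ∀ i, X i => b i) ∘ fun (ω : ∀ i, X i) i => if i ∈ U then ω i else x₀ i) =
        fun _ => x₀ i := by
      funext ω
      simp [hi]
    rw [this, MeasurableSpace.comap_const]
    exact bot_le

/-- Measurable functions of disjoint sets of coordinates of a product space are independent. -/
lemma indepFun_of_dependsOn {ι : Type*} {X : ι → Type*} [∀ i, MeasurableSpace (X i)]
    (μ : ∀ i, Measure (X i)) [∀ i, IsProbabilityMeasure (μ i)] {β γ : Type*}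
    [MeasurableSpace β] [MeasurableSpace γ] {f : (∀ i, X i) → β} {g : (∀ i, X i) → γ}
    {S T : Set ι} (hST : Disjoint S T) (hf : Measurable f) (hg : Measurable g)
    (hfS : DependsOn f S) (hgT : DependsOn g T) : IndepFun f g (Measure.infinitePi μ) := by
  have x₀ : ∀ i, X i := fun i => (nonempty_of_isProbabilityMeasure (μ i)).some
  have hind : iIndepFun (fun i (ω : ∀ i, X i) => ω i) (Measure.infinitePi μ) :=
    iIndepFun_infinitePi (X := fun _ x => x) (fun _ => measurable_id)
  have key := indep_iSup_of_disjoint (fun i => (measurable_pi_apply i).comap_le) hind.iIndep hST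
  refine indep_of_indep_of_le_left (indep_of_indep_of_le_right key ?_) ?_
  · exact comap_le_of_dependsOn x₀ hg hgT _ fun i hi => le_iSup₂_of_le i hi le_rfl
  · exact comap_le_of_dependsOn x₀ hf hfS _ fun i hi => le_iSup₂_of_le i hi le_rfl

/-- A configuration: which edges are present, and the weights of all the edges. -/
abbrev Cfg : Type := Edge → Bool × ℝ

/-- The law of the state of one edge: present with probability `p`, and an independent weight. -/
noncomputable def edgeLaw (p : ℝ) (F : Measure ℝ) : Measure (Bool × ℝ) :=
  (ENNReal.ofReal p • Measure.dirac true + ENNReal.ofReal (1 - p) • Measure.dirac false).prod F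

/-- The law of the configuration of the random weighted graph. -/
noncomputable def cfgLaw (p : ℝ) (F : Measure ℝ) : Measure Cfg :=
  Measure.infinitePi fun _ => edgeLaw p F

lemma isProbabilityMeasure_bernoulli {p : ℝ} (hp0 : 0 ≤ p) (hp1 : p ≤ 1) :
    IsProbabilityMeasure (ENNReal.ofReal p • Measure.dirac true +
      ENNReal.ofReal (1 - p) • Measure.dirac false : Measure Bool) := by
  constructor
  simp only [Measure.coe_add, Measure.coe_smul, Pi.add_apply, Pi.smul_apply, measure_univ,
    smul_eq_mul, mul_one]
  rw [← ENNReal.ofReal_add hp0 (by linarith)]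
  simp

lemma isProbabilityMeasure_edgeLaw {p : ℝ} (hp0 : 0 ≤ p) (hp1 : p ≤ 1) (F : Measure ℝ)
    [IsProbabilityMeasure F] : IsProbabilityMeasure (edgeLaw p F) := by
  have := isProbabilityMeasure_bernoulli hp0 hp1
  unfold edgeLaw
  infer_instance

/-- The configuration of any model has the law `cfgLaw p F`. -/
lemma IsModel.measurePreserving {Ω : Type*} [MeasurableSpace Ω] {P : Measure Ω}
    [IsProbabilityMeasure P] {p : ℝ} (hp0 : 0 ≤ p) {F : Measure ℝ}
    {α : Edge → Ω → Bool} {v : Edge → Ω → ℝ} (h : IsModel P p F α v) :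
    MeasurePreserving (fun ω e => (α e ω, v e ω)) P (cfgLaw p F) := by
  have hm : ∀ e, Measurable fun ω => (α e ω, v e ω) := fun e =>
    (h.measurable_present e).prodMk (h.measurable_weight e)
  refine ⟨measurable_pi_iff.2 hm, ?_⟩
  rw [h.indep_edges.map_fun_eq_infinitePi_map hm, cfgLaw]
  congr 1
  funext e
  rw [(indepFun_iff_map_prod_eq_prod_map_map (h.measurable_present e).aemeasurable
    (h.measurable_weight e).aemeasurable).1 (h.indep_present_weight e), h.law_weight, edgeLaw]
  congr 1
  have h1 : P.map (α e) {true} = ENNReal.ofReal p := by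
    rw [Measure.map_apply (h.measurable_present e) (measurableSet_singleton _)]
    exact h.prob_present e
  have h2 : P.map (α e) {false} = ENNReal.ofReal (1 - p) := by
    have : IsProbabilityMeasure (P.map (α e)) :=
      Measure.isProbabilityMeasure_map (h.measurable_present e).aemeasurable
    have h3 : ({false} : Set Bool) = {true}ᶜ := by ext b; cases b <;> simp
    rw [h3, prob_compl_eq_one_sub (measurableSet_singleton _), h1, ENNReal.ofReal_sub _ hp0]
    simp
  refine Measure.ext_of_singleton fun b => ?_
  cases b
  · rw [h2]; simp
  · rw [h1]; simp

section Marginals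

variable {p : ℝ} {F : Measure ℝ} [IsProbabilityMeasure F]

lemma isProbabilityMeasure_cfgLaw (hp0 : 0 ≤ p) (hp1 : p ≤ 1) :
    IsProbabilityMeasure (cfgLaw p F) := by
  have := isProbabilityMeasure_edgeLaw hp0 hp1 F
  unfold cfgLaw
  infer_instance

/-- The law of the configuration is invariant under injective relabellings of the edges. -/
lemma measurePreserving_relabelEdges (hp0 : 0 ≤ p) (hp1 : p ≤ 1) {φ : Edge → Edge}
    (hφ : Function.Injective φ) :
    MeasurePreserving (fun (ω : Cfg) e => ω (φ e)) (cfgLaw p F) (cfgLaw p F) := by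
  have := isProbabilityMeasure_edgeLaw hp0 hp1 F
  refine ⟨by fun_prop, ?_⟩
  exact Measure.map_infinitePi_infinitePi_of_inj (P := fun _ : Edge => edgeLaw p F) hφ

lemma cfgLaw_indepFun (hp0 : 0 ≤ p) (hp1 : p ≤ 1) {β γ : Type*}
    [MeasurableSpace β] [MeasurableSpace γ] {f : Cfg → β} {g : Cfg → γ}
    {S T : Set Edge} (hST : Disjoint S T) (hf : Measurable f) (hg : Measurable g)
    (hfS : DependsOn f S) (hgT : DependsOn g T) : IndepFun f g (cfgLaw p F) := by
  have := isProbabilityMeasure_edgeLaw hp0 hp1 F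
  exact indepFun_of_dependsOn _ hST hf hg hfS hgT

lemma measurePreserving_edge (hp0 : 0 ≤ p) (hp1 : p ≤ 1) (e : Edge) :
    MeasurePreserving (fun ω : Cfg => ω e) (cfgLaw p F) (edgeLaw p F) := by
  have := isProbabilityMeasure_edgeLaw hp0 hp1 F
  exact measurePreserving_eval_infinitePi (fun _ : Edge => edgeLaw p F) e

lemma measurePreserving_weight (hp0 : 0 ≤ p) (hp1 : p ≤ 1) (e : Edge) :
    MeasurePreserving (fun ω : Cfg => (ω e).2) (cfgLaw p F) F := by
  have := isProbabilityMeasure_bernoulli hp0 hp1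
  exact (measurePreserving_snd (μ := (ENNReal.ofReal p • Measure.dirac true +
    ENNReal.ofReal (1 - p) • Measure.dirac false : Measure Bool)) (ν := F)).comp
    (measurePreserving_edge hp0 hp1 e)

lemma measurePreserving_present (hp0 : 0 ≤ p) (hp1 : p ≤ 1) (e : Edge) :
    MeasurePreserving (fun ω : Cfg => (ω e).1) (cfgLaw p F) (ENNReal.ofReal p • Measure.dirac true +
    ENNReal.ofReal (1 - p) • Measure.dirac false : Measure Bool) := by
  have := isProbabilityMeasure_bernoulli hp0 hp1
  exact (measurePreserving_fst (μ := (ENNReal.ofReal p • Measure.dirac true +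
    ENNReal.ofReal (1 - p) • Measure.dirac false : Measure Bool)) (ν := F)).comp
    (measurePreserving_edge hp0 hp1 e)

lemma measurableSet_present (e : Edge) (b : Bool) : MeasurableSet {ω : Cfg | (ω e).1 = b} :=
  (measurable_fst.comp (measurable_pi_apply e)) (measurableSet_singleton b)

lemma cfgLaw_present (hp0 : 0 ≤ p) (hp1 : p ≤ 1) (e : Edge) :
    cfgLaw p F {ω | (ω e).1 = true} = ENNReal.ofReal p := by
  have h := (measurePreserving_present (F := F) hp0 hp1 e).measure_preimage
    (measurableSet_singleton true).nullMeasurableSet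
  refine h.trans ?_
  simp

lemma cfgLaw_absent (hp0 : 0 ≤ p) (hp1 : p ≤ 1) (e : Edge) :
    cfgLaw p F {ω | (ω e).1 = false} = ENNReal.ofReal (1 - p) := by
  have h := (measurePreserving_present (F := F) hp0 hp1 e).measure_preimage
    (measurableSet_singleton false).nullMeasurableSet
  refine h.trans ?_
  simp

lemma lintegral_weight (hp0 : 0 ≤ p) (hp1 : p ≤ 1) (e : Edge) {f : ℝ → ℝ≥0∞}
    (hf : Measurable f) : ∫⁻ ω, f (ω e).2 ∂cfgLaw p F = ∫⁻ x, f x ∂F :=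
  (measurePreserving_weight hp0 hp1 e).lintegral_comp hf

/-- Presence and weight of an edge are independent. -/
lemma lintegral_present_weight (hp0 : 0 ≤ p) (hp1 : p ≤ 1) (e : Edge) {f : ℝ → ℝ≥0∞}
    (hf : Measurable f) :
    ∫⁻ ω in {ω : Cfg | (ω e).1 = true}, f (ω e).2 ∂cfgLaw p F =
      ENNReal.ofReal p * ∫⁻ x, f x ∂F := by
  have := isProbabilityMeasure_bernoulli hp0 hp1
  have h1 : MeasurableSet {x : Bool × ℝ | x.1 = true} := measurable_fst (measurableSet_singleton _)
  have h2 := (measurePreserving_edge (F := F) hp0 hp1 e).setLIntegral_comp_preimage h1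
    (hf.comp measurable_snd)
  refine h2.trans ?_
  rw [edgeLaw, ← lintegral_indicator h1, lintegral_prod _
    ((hf.comp measurable_snd).indicator h1).aemeasurable, lintegral_add_measure,
    lintegral_smul_measure, lintegral_smul_measure, lintegral_dirac, lintegral_dirac]
  simp [Set.indicator]

lemma ae_weight_pos (hp0 : 0 ≤ p) (hp1 : p ≤ 1) (hFpos : ∀ᵐ x ∂F, 0 < x) :
    ∀ᵐ ω ∂cfgLaw p F, ∀ e, 0 < (ω e).2 :=
  ae_all_iff.2 fun e => (measurePreserving_weight hp0 hp1 e).quasiMeasurePreserving.ae hFpos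

end Marginals

/-! ### Paths and their weights -/

/-- The set of edges that are present in the configuration `ω`. -/
def openEdges (ω : Cfg) : Set Edge := {e | (ω e).1 = true}

/-- The set of edges between vertices of `[a, b)`. -/
def inside (a b : ℤ) : Set Edge := {e | a ≤ e.1.1 ∧ e.1.2 < b}

/-- The weight of an edge as an extended nonnegative number, which makes suprema and sums
unconditionally meaningful. Almost surely no weight is negative, and nothing is truncated. -/
noncomputable def wt (ω : Cfg) (e : Edge) : ℝ≥0∞ := ENNReal.ofReal (ω e).2

/-- The weight of a path as an extended nonnegative number. -/
noncomputable def pathWt (ω : Cfg) (π : List Edge) : ℝ≥0∞ := (π.map (wt ω)).sum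

/-- The maximal weight of a path that starts at `i` and uses only vertices of `[a, b)`
(or is empty). -/
noncomputable def maxFrom (a b i : ℤ) (ω : Cfg) : ℝ≥0∞ :=
  ⨆ (x : ℤ × List Edge) (_ : IsPath (openEdges ω ∩ inside a b) i x.1 x.2), pathWt ω x.2

/-- The maximal weight of a path in `[a, b)`, with free endpoints. -/
noncomputable def maxWt (a b : ℤ) (ω : Cfg) : ℝ≥0∞ := ⨆ i, maxFrom a b i ω

@[simp] lemma pathWt_nil (ω : Cfg) : pathWt ω [] = 0 := rfl

@[simp] lemma pathWt_cons (ω : Cfg) (e : Edge) (π : List Edge) :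
    pathWt ω (e :: π) = wt ω e + pathWt ω π := by simp [pathWt]

@[simp] lemma pathWt_append (ω : Cfg) (π π' : List Edge) :
    pathWt ω (π ++ π') = pathWt ω π + pathWt ω π' := by simp [pathWt]

lemma IsPath.mono {E E' : Set Edge} (hE : E ⊆ E') :
    ∀ {π : List Edge} {i j : ℤ}, IsPath E i j π → IsPath E' i j π
  | [], _, _, h => h
  | _ :: _, _, _, h => ⟨hE h.1, h.2.1, h.2.2.mono hE⟩

lemma IsPath.le {E : Set Edge} : ∀ {π : List Edge} {i j : ℤ}, IsPath E i j π → i ≤ j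
  | [], _, _, h => le_of_eq h
  | e :: _, _, _, h => by
    have h1 := h.2.2.le
    have h2 := e.2
    have h3 := h.2.1
    omega

lemma IsPath.append {E : Set Edge} : ∀ {π π' : List Edge} {i j k : ℤ}, IsPath E i j π →
    IsPath E j k π' → IsPath E i k (π ++ π')
  | [], _, _, _, _, h, h' => by
    obtain rfl : _ = _ := h
    exact h'
  | _ :: _, _, _, _, _, h, h' => ⟨h.1, h.2.1, h.2.2.append h'⟩

/-- The endpoints of a nonempty path in `[a, b)` are in `[a, b)`. -/
lemma IsPath.endpoints {E : Set Edge} {a b : ℤ} : ∀ {π : List Edge} {i j : ℤ},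
    IsPath (E ∩ inside a b) i j π → π ≠ [] → a ≤ i ∧ j < b
  | [], _, _, _, h => absurd rfl h
  | [e], i, j, h, _ => by
    obtain ⟨⟨-, h1, h2⟩, rfl, h4 : e.1.2 = j⟩ := h
    exact ⟨h1, h4 ▸ h2⟩
  | e :: e' :: π, i, j, h, _ => by
    obtain ⟨⟨-, h1, h2⟩, rfl, h4⟩ := h
    exact ⟨h1, (h4.endpoints (by simp)).2⟩

/-- A path between vertices of `[a, b)` stays in `[a, b)`. -/
lemma IsPath.restrict {E : Set Edge} {a b : ℤ} : ∀ {π : List Edge} {i j : ℤ},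
    IsPath E i j π → a ≤ i → j < b → IsPath (E ∩ inside a b) i j π
  | [], _, _, h, _, _ => h
  | e :: _, i, j, h, ha, hb => by
    have h1 := h.2.2.le
    have h2 := e.2
    have h3 := h.2.1
    exact ⟨⟨h.1, by omega, by omega⟩, h3, h.2.2.restrict (by omega) hb⟩

lemma pathWt_le_maxFrom {a b i j : ℤ} {ω : Cfg} {π : List Edge}
    (h : IsPath (openEdges ω ∩ inside a b) i j π) : pathWt ω π ≤ maxFrom a b i ω :=
  le_iSup₂ (f := fun (x : ℤ × List Edge) (_ : IsPath (openEdges ω ∩ inside a b) i x.1 x.2) =>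
    pathWt ω x.2) (j, π) h

lemma maxFrom_le_maxWt (a b i : ℤ) (ω : Cfg) : maxFrom a b i ω ≤ maxWt a b ω :=
  le_iSup (fun i => maxFrom a b i ω) i

lemma pathWt_le_maxWt {a b i j : ℤ} {ω : Cfg} {π : List Edge}
    (h : IsPath (openEdges ω ∩ inside a b) i j π) : pathWt ω π ≤ maxWt a b ω :=
  (pathWt_le_maxFrom h).trans (maxFrom_le_maxWt a b i ω)

lemma maxWt_le {a b : ℤ} {ω : Cfg} {x : ℝ≥0∞}
    (h : ∀ i j π, IsPath (openEdges ω ∩ inside a b) i j π → pathWt ω π ≤ x) : maxWt a b ω ≤ x :=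
  iSup_le fun i => iSup₂_le fun y hy => h i y.1 y.2 hy

lemma inside_mono {a b a' b' : ℤ} (ha : a' ≤ a) (hb : b ≤ b') : inside a b ⊆ inside a' b' :=
  fun _ he => ⟨ha.trans he.1, he.2.trans_le hb⟩

lemma maxWt_mono {a b a' b' : ℤ} (ha : a' ≤ a) (hb : b ≤ b') (ω : Cfg) :
    maxWt a b ω ≤ maxWt a' b' ω :=
  maxWt_le fun _ _ _ h =>
    pathWt_le_maxWt (h.mono (Set.inter_subset_inter_right _ (inside_mono ha hb)))

/-- A path can be prolonged at its beginning. -/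
lemma wt_add_maxFrom_le {a b : ℤ} {ω : Cfg} {e : Edge} (he : e ∈ openEdges ω ∩ inside a b) :
    wt ω e + maxFrom a b e.1.2 ω ≤ maxFrom a b e.1.1 ω := by
  unfold maxFrom
  rw [ENNReal.add_biSup' (p := fun x : ℤ × List Edge =>
    IsPath (openEdges ω ∩ inside a b) e.1.2 x.1 x.2) ⟨(e.1.2, []), rfl⟩]
  refine iSup₂_le fun x hx => ?_
  rw [← pathWt_cons]
  exact pathWt_le_maxFrom (j := x.1) ⟨he, rfl, hx⟩

/-! ### Measurability and dependence on the edges -/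

lemma measurable_wt (e : Edge) : Measurable fun ω => wt ω e := by
  unfold wt
  fun_prop

lemma measurable_pathWt : ∀ π : List Edge, Measurable fun ω => pathWt ω π
  | [] => measurable_const
  | e :: π => by
    simp only [pathWt_cons]
    exact (measurable_wt e).add (measurable_pathWt π)

lemma measurableSet_isPath (A : Set Edge) : ∀ (π : List Edge) (i j : ℤ),
    MeasurableSet {ω | IsPath (openEdges ω ∩ A) i j π}
  | [], i, j => MeasurableSet.const (i = j)
  | e :: π, i, j =>
    ((measurableSet_present e true).inter (MeasurableSet.const (e ∈ A))).inter
      ((MeasurableSet.const (e.1.1 = i)).inter (measurableSet_isPath A π e.1.2 j))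

lemma measurable_maxFrom (a b i : ℤ) : Measurable (maxFrom a b i) := by
  classical
  unfold maxFrom
  refine Measurable.iSup fun x => ?_
  have h : (fun ω => ⨆ (_ : IsPath (openEdges ω ∩ inside a b) i x.1 x.2), pathWt ω x.2) =
      fun ω => if IsPath (openEdges ω ∩ inside a b) i x.1 x.2 then pathWt ω x.2 else 0 := by
    funext ω
    split_ifs with h <;> simp [h]
  rw [h]
  exact Measurable.ite (measurableSet_isPath _ _ _ _) (measurable_pathWt _) measurable_const

lemma measurable_maxWt (a b : ℤ) : Measurable (maxWt a b) :=
  Measurable.iSup fun i => measurable_maxFrom a b i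

lemma IsPath.congr_cfg {A : Set Edge} {ω ω' : Cfg} (h : ∀ e ∈ A, ω e = ω' e) :
    ∀ {π : List Edge} {i j : ℤ}, IsPath (openEdges ω ∩ A) i j π →
      IsPath (openEdges ω' ∩ A) i j π ∧ pathWt ω π = pathWt ω' π
  | [], _, _, hp => ⟨hp, rfl⟩
  | e :: π, i, j, ⟨⟨h1, h2⟩, h3, h4⟩ => by
    obtain ⟨h5, h6⟩ := h4.congr_cfg h
    have h7 := h e h2
    refine ⟨⟨⟨?_, h2⟩, h3, h5⟩, ?_⟩
    · simpa [openEdges, ← h7] using h1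
    · rw [pathWt_cons, pathWt_cons, h6, wt, wt, h7]

lemma dependsOn_maxFrom (a b i : ℤ) : DependsOn (maxFrom a b i) (inside a b) := by
  have key : ∀ ω ω' : Cfg, (∀ e ∈ inside a b, ω e = ω' e) → maxFrom a b i ω ≤ maxFrom a b i ω' := by
    intro ω ω' h
    refine iSup₂_le fun x hx => ?_
    obtain ⟨h1, h2⟩ := hx.congr_cfg h
    rw [h2]
    exact pathWt_le_maxFrom h1
  exact fun ω ω' h => le_antisymm (key ω ω' h) (key ω' ω fun e he => (h e he).symm)

lemma dependsOn_maxWt (a b : ℤ) : DependsOn (maxWt a b) (inside a b) := fun _ _ h =>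
  iSup_congr fun i => dependsOn_maxFrom a b i h

/-! ### Relabelling the vertices -/

/-- The map of edges induced by a strictly increasing map of vertices. -/
def mapEdge (φ : ℤ → ℤ) (hφ : StrictMono φ) (e : Edge) : Edge := ⟨(φ e.1.1, φ e.1.2), hφ e.2⟩

lemma mapEdge_injective {φ : ℤ → ℤ} (hφ : StrictMono φ) : Function.Injective (mapEdge φ hφ) := by
  intro e e' h
  have h1 : φ e.1.1 = φ e'.1.1 := congrArg (fun x : Edge => x.1.1) h
  have h2 : φ e.1.2 = φ e'.1.2 := congrArg (fun x : Edge => x.1.2) h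
  exact Subtype.ext (Prod.ext (hφ.injective h1) (hφ.injective h2))

/-- The configuration induced on the vertices `φ x`, `x ∈ ℤ`, seen as a configuration on `ℤ`. -/
def relabel (φ : ℤ → ℤ) (hφ : StrictMono φ) (ω : Cfg) : Cfg := fun e => ω (mapEdge φ hφ e)

lemma IsPath.map_relabel {φ : ℤ → ℤ} (hφ : StrictMono φ) {ω : Cfg} {a b a' b' : ℤ}
    (h : ∀ x, a ≤ x → x < b → a' ≤ φ x ∧ φ x < b') : ∀ {π : List Edge} {i j : ℤ},
    IsPath (openEdges (relabel φ hφ ω) ∩ inside a b) i j π →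
      IsPath (openEdges ω ∩ inside a' b') (φ i) (φ j) (π.map (mapEdge φ hφ)) ∧
      pathWt (relabel φ hφ ω) π = pathWt ω (π.map (mapEdge φ hφ))
  | [], _, _, hp => ⟨congrArg φ hp, rfl⟩
  | e :: π, i, j, ⟨⟨h1, h2⟩, h3, h4⟩ => by
    obtain ⟨h5, h6⟩ := h4.map_relabel hφ h
    have h7 := e.2
    have h8 := h2.1
    have h9 := h2.2
    refine ⟨⟨⟨h1, (h e.1.1 h8 (by omega)).1, (h e.1.2 (by omega) h9).2⟩, ?_, h5⟩, ?_⟩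
    · rw [← h3]; rfl
    · rw [List.map_cons, pathWt_cons, pathWt_cons, h6]; rfl

lemma maxFrom_relabel_le {φ : ℤ → ℤ} (hφ : StrictMono φ) (ω : Cfg) {a b a' b' : ℤ}
    (h : ∀ x, a ≤ x → x < b → a' ≤ φ x ∧ φ x < b') (i : ℤ) :
    maxFrom a b i (relabel φ hφ ω) ≤ maxFrom a' b' (φ i) ω := by
  refine iSup₂_le fun x hx => ?_
  obtain ⟨h1, h2⟩ := hx.map_relabel hφ h
  rw [h2]
  exact pathWt_le_maxFrom h1

lemma strictMono_add_int (k : ℤ) : StrictMono fun x : ℤ => x + k := fun _ _ h => by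
  simpa using h

/-- The configuration seen from the vertex `k`. -/
def shift (k : ℤ) (ω : Cfg) : Cfg := relabel (· + k) (strictMono_add_int k) ω

lemma maxWt_shift (k a b : ℤ) (ω : Cfg) : maxWt a b (shift k ω) = maxWt (a + k) (b + k) ω := by
  refine le_antisymm (iSup_le fun i => ?_) (iSup_le fun i => ?_)
  · exact (maxFrom_relabel_le _ ω (by intro x _ _; constructor <;> omega) i).trans
      (maxFrom_le_maxWt _ _ _ _)
  · have h1 : relabel (· + -k) (strictMono_add_int (-k)) (shift k ω) = ω := by
      funext e
      have h2 : mapEdge (· + k) (strictMono_add_int k)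
          (mapEdge (· + -k) (strictMono_add_int (-k)) e) = e :=
        Subtype.ext (Prod.ext (by simp [mapEdge]) (by simp [mapEdge]))
      exact congrArg ω h2
    have h3 := maxFrom_relabel_le (strictMono_add_int (-k)) (shift k ω)
      (a := a + k) (b := b + k) (a' := a) (b' := b) (by intro x _ _; constructor <;> omega) i
    rw [h1] at h3
    exact h3.trans (maxFrom_le_maxWt _ _ _ _)

/-! ### Cutting paths at the ends of blocks -/

/-- The edge of length `l + 1` that starts at `x`. -/
def edge (x : ℤ) (l : ℕ) : Edge := ⟨(x, x + 1 + l), by simp only; omega⟩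

/-- The excess of the weight of an edge over `c` times its length. -/
noncomputable def excess (c : ℝ) (ω : Cfg) (e : Edge) : ℝ≥0∞ :=
  ENNReal.ofReal ((ω e).2 - c * (e.1.2 - e.1.1 : ℤ))

/-- The sum of the excesses of all the edges that start in `[a, a + m)` and end outside of it; the
edge with indices `i < m` and `r` leads from `a + i` to `a + m + r`. -/
noncomputable def exitExcess (c : ℝ) (a : ℤ) (m : ℕ) (ω : Cfg) : ℝ≥0∞ :=
  ∑ i ∈ Finset.range m, ∑' r : ℕ, excess c ω (edge (a + i) (m - 1 - i + r))

/-- The contribution of the block `[a, a + m)` to the upper bound for the weight of a path: the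
best path in the block, and the excesses of all the edges leaving it. -/
noncomputable def blockWt (c : ℝ) (a : ℤ) (m : ℕ) (ω : Cfg) : ℝ≥0∞ :=
  maxWt a (a + m) ω + exitExcess c a m ω

lemma wt_le_add_excess {c : ℝ} (ω : Cfg) (e : Edge) :
    wt ω e ≤ ENNReal.ofReal (c * (e.1.2 - e.1.1 : ℤ)) + excess c ω e := by
  refine le_trans (ENNReal.ofReal_le_ofReal ?_) ENNReal.ofReal_add_le
  linarith

lemma excess_le_exitExcess {c : ℝ} {a : ℤ} {m : ℕ} {ω : Cfg} {e : Edge} (h1 : a ≤ e.1.1)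
    (h2 : e.1.1 < a + m) (h3 : a + m ≤ e.1.2) : excess c ω e ≤ exitExcess c a m ω := by
  obtain ⟨i, hi⟩ := Int.eq_ofNat_of_zero_le (sub_nonneg.2 h1)
  obtain ⟨r, hr⟩ := Int.eq_ofNat_of_zero_le (sub_nonneg.2 h3)
  have him : i < m := by omega
  have he : e = edge (a + i) (m - 1 - i + r) :=
    Subtype.ext (Prod.ext (by simp only [edge]; omega) (by simp only [edge]; omega))
  rw [he]
  exact (ENNReal.le_tsum (f := fun r => excess c ω (edge (a + i) (m - 1 - i + r))) r).trans
    (Finset.single_le_sum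
      (f := fun i : ℕ => ∑' r : ℕ, excess c ω (edge (a + i) (m - 1 - i + r)))
      (fun _ _ => zero_le) (Finset.mem_range.2 him))

/-- A path is cut at the edges that lead from one block to another. Such an edge costs at most `c`
times its length plus its excess, and at most one edge of the path leaves any given block. -/
lemma pathWt_le_sum_blockWt_aux {c : ℝ} (hc : 0 ≤ c) {m : ℕ} (hm : 0 < m) (k : ℕ) (ω : Cfg) :
    ∀ (π : List Edge) (i j : ℤ) (b : ℕ), IsPath (openEdges ω) i j π → (b * m : ℤ) ≤ i →
      i < b * m + m → j < k * m →
      pathWt ω π ≤ ENNReal.ofReal (c * (j - i : ℤ)) + maxFrom (b * m) (b * m + m) i ω +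
        exitExcess c (b * m) m ω + ∑ b' ∈ Finset.Ioo b k, blockWt c (b' * m) m ω
  | [], _, _, _, _, _, _, _ => by simp
  | e :: π, i, j, b, ⟨h1, h2, h3⟩, hbi, hib, hjk => by
    subst h2
    have hlt := e.2
    have hle := h3.le
    have hc1 : (0 : ℝ) ≤ c * (e.1.2 - e.1.1 : ℤ) :=
      mul_nonneg hc (by exact_mod_cast (by omega : (0 : ℤ) ≤ e.1.2 - e.1.1))
    have hc2 : (0 : ℝ) ≤ c * (j - e.1.2 : ℤ) :=
      mul_nonneg hc (by exact_mod_cast (by omega : (0 : ℤ) ≤ j - e.1.2))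
    have hsum : ENNReal.ofReal (c * (j - e.1.1 : ℤ)) =
        ENNReal.ofReal (c * (e.1.2 - e.1.1 : ℤ)) + ENNReal.ofReal (c * (j - e.1.2 : ℤ)) := by
      rw [← ENNReal.ofReal_add hc1 hc2]
      congr 1
      push_cast
      ring
    rw [pathWt_cons]
    by_cases hin : e.1.2 < b * m + m
    · have ih := pathWt_le_sum_blockWt_aux hc hm k ω π e.1.2 j b h3 (by omega) hin hjk
      have h4 := wt_add_maxFrom_le (a := b * m) (b := b * m + m) (ω := ω) (e := e)
        ⟨h1, hbi, hin⟩
      calc wt ω e + pathWt ω π ≤ wt ω e + (ENNReal.ofReal (c * (j - e.1.2 : ℤ)) +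
            maxFrom (b * m) (b * m + m) e.1.2 ω + exitExcess c (b * m) m ω +
            ∑ b' ∈ Finset.Ioo b k, blockWt c (b' * m) m ω) := by gcongr
        _ = ENNReal.ofReal (c * (j - e.1.2 : ℤ)) +
            (wt ω e + maxFrom (b * m) (b * m + m) e.1.2 ω) + exitExcess c (b * m) m ω +
            ∑ b' ∈ Finset.Ioo b k, blockWt c (b' * m) m ω := by ring
        _ ≤ _ := by
          gcongr
    · push Not at hin
      have hm' : (0 : ℤ) < m := by exact_mod_cast hm
      have hnn : 0 ≤ e.1.2 / (m : ℤ) := Int.ediv_nonneg (by nlinarith) hm'.le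
      obtain ⟨b', hb'⟩ := Int.eq_ofNat_of_zero_le hnn
      have h5 : (b' * m : ℤ) ≤ e.1.2 := hb' ▸ Int.ediv_mul_le _ hm'.ne'
      have h6 : e.1.2 < b' * m + m := by
        have := Int.lt_ediv_add_one_mul_self e.1.2 hm'
        rw [hb'] at this
        linarith
      have hbb' : b < b' := by
        have : (b * m : ℤ) < b' * m := by
          by_contra hcon
          push Not at hcon
          have : (b' : ℤ) < b + 1 := by
            by_contra h7
            push Not at h7
            nlinarith
          have h8 : (b' : ℤ) = b ∨ (b' : ℤ) < b := by omega
          rcases h8 with h8 | h8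
          · rw [h8] at h6; omega
          · nlinarith
        exact_mod_cast lt_of_mul_lt_mul_right this hm'.le
      have hb'k : b' < k := by
        have : (b' * m : ℤ) < k * m := by omega
        exact_mod_cast lt_of_mul_lt_mul_right this hm'.le
      have ih := pathWt_le_sum_blockWt_aux hc hm k ω π e.1.2 j b' h3 h5 h6 hjk
      have h7 : blockWt c (b' * m) m ω + ∑ b'' ∈ Finset.Ioo b' k, blockWt c (b'' * m) m ω ≤
          ∑ b'' ∈ Finset.Ioo b k, blockWt c (b'' * m) m ω := by
        rw [← Finset.sum_insert (f := fun b'' : ℕ => blockWt c (b'' * m) m ω)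
          (by simp : b' ∉ Finset.Ioo b' k)]
        refine Finset.sum_le_sum_of_subset fun x hx => ?_
        simp only [Finset.mem_insert, Finset.mem_Ioo] at hx ⊢
        omega
      have h8 := excess_le_exitExcess (c := c) (ω := ω) hbi hib hin
      calc wt ω e + pathWt ω π ≤ (ENNReal.ofReal (c * (e.1.2 - e.1.1 : ℤ)) +
              exitExcess c (b * m) m ω) + (ENNReal.ofReal (c * (j - e.1.2 : ℤ)) +
            maxWt (b' * m) (b' * m + m) ω + exitExcess c (b' * m) m ω +
            ∑ b'' ∈ Finset.Ioo b' k, blockWt c (b'' * m) m ω) := by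
            gcongr
            · exact (wt_le_add_excess ω e).trans (by gcongr)
            · exact ih.trans (by gcongr; exact maxFrom_le_maxWt _ _ _ _)
        _ = ENNReal.ofReal (c * (j - e.1.1 : ℤ)) + exitExcess c (b * m) m ω +
            (blockWt c (b' * m) m ω + ∑ b'' ∈ Finset.Ioo b' k, blockWt c (b'' * m) m ω) := by
            rw [hsum, blockWt]
            ring
        _ ≤ _ := by
          refine add_le_add ?_ h7
          gcongr
          exact le_self_add

/-- The upper bound for the best path in `k` consecutive blocks of length `m`. -/
lemma maxWt_le_sum_blockWt {c : ℝ} (hc : 0 ≤ c) {m : ℕ} (hm : 0 < m) (k : ℕ) (ω : Cfg) :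
    maxWt 0 (k * m) ω ≤ ENNReal.ofReal (c * (k * m)) +
      ∑ b ∈ Finset.range k, blockWt c (b * m) m ω := by
  refine maxWt_le fun i j π hπ => ?_
  rcases eq_or_ne π [] with rfl | hne
  · simp
  obtain ⟨hi, hj⟩ := hπ.endpoints hne
  have hle := hπ.le
  have hm' : (0 : ℤ) < m := by exact_mod_cast hm
  obtain ⟨b, hb⟩ := Int.eq_ofNat_of_zero_le (Int.ediv_nonneg hi hm'.le)
  have h5 : (b * m : ℤ) ≤ i := hb ▸ Int.ediv_mul_le _ hm'.ne'
  have h6 : i < b * m + m := by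
    have := Int.lt_ediv_add_one_mul_self i hm'
    rw [hb] at this
    linarith
  have hbk : b < k := by
    have : (b * m : ℤ) < k * m := by omega
    exact_mod_cast lt_of_mul_lt_mul_right this hm'.le
  have key := pathWt_le_sum_blockWt_aux hc hm k ω π i j b (hπ.mono Set.inter_subset_left) h5 h6 hj
  refine key.trans ?_
  have h7 : blockWt c (b * m) m ω + ∑ b' ∈ Finset.Ioo b k, blockWt c (b' * m) m ω ≤
      ∑ b' ∈ Finset.range k, blockWt c (b' * m) m ω := by
    rw [← Finset.sum_insert (f := fun b' : ℕ => blockWt c (b' * m) m ω)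
      (by simp : b ∉ Finset.Ioo b k)]
    refine Finset.sum_le_sum_of_subset fun x hx => ?_
    simp only [Finset.mem_insert, Finset.mem_Ioo, Finset.mem_range] at hx ⊢
    omega
  calc _ ≤ ENNReal.ofReal (c * (k * m)) + maxWt (b * m) (b * m + m) ω +
        exitExcess c (b * m) m ω + ∑ b' ∈ Finset.Ioo b k, blockWt c (b' * m) m ω := by
        gcongr
        · have : ((j - i : ℤ) : ℝ) ≤ ((k * m : ℤ) : ℝ) := by exact_mod_cast (by omega)
          simpa using this
        · exact maxFrom_le_maxWt _ _ _ _
    _ = ENNReal.ofReal (c * (k * m)) + (blockWt c (b * m) m ω +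
        ∑ b' ∈ Finset.Ioo b k, blockWt c (b' * m) m ω) := by rw [blockWt]; ring
    _ ≤ _ := by gcongr

/-! ### The blocks are independent and identically distributed -/

lemma measurable_excess (c : ℝ) (e : Edge) : Measurable fun ω => excess c ω e := by
  unfold excess
  fun_prop

lemma measurable_exitExcess (c : ℝ) (a : ℤ) (m : ℕ) : Measurable (exitExcess c a m) := by
  unfold exitExcess
  exact Finset.measurable_fun_sum _ fun i _ => Measurable.tsum fun r => measurable_excess c _

lemma measurable_blockWt (c : ℝ) (a : ℤ) (m : ℕ) : Measurable (blockWt c a m) :=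
  (measurable_maxWt _ _).add (measurable_exitExcess c a m)

/-- The set of edges that start in `[a, b)`. -/
def startIn (a b : ℤ) : Set Edge := {e | a ≤ e.1.1 ∧ e.1.1 < b}

lemma inside_subset_startIn (a b : ℤ) : inside a b ⊆ startIn a b := fun e he =>
  ⟨he.1, e.2.trans he.2⟩

lemma dependsOn_blockWt (c : ℝ) (a : ℤ) (m : ℕ) :
    DependsOn (blockWt c a m) (startIn a (a + m)) := by
  intro ω ω' h
  unfold blockWt exitExcess
  congr 1
  · exact (dependsOn_maxWt a (a + m)).mono (inside_subset_startIn _ _) h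
  · refine Finset.sum_congr rfl fun i hi => tsum_congr fun r => ?_
    have hi' := Finset.mem_range.1 hi
    rw [excess, excess, h]
    simp only [startIn, edge, Set.mem_ofPred_eq]
    omega

lemma blockWt_eq_shift (c : ℝ) (a : ℤ) (m : ℕ) (ω : Cfg) :
    blockWt c a m ω = blockWt c 0 m (shift a ω) := by
  unfold blockWt
  rw [maxWt_shift]
  congr 1
  · congr 1 <;> ring
  · refine Finset.sum_congr rfl fun i _ => tsum_congr fun r => ?_
    have h : mapEdge (· + a) (strictMono_add_int a) (edge (0 + i) (m - 1 - i + r)) =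
        edge (a + i) (m - 1 - i + r) :=
      Subtype.ext (Prod.ext (by simp only [mapEdge, edge]; ring)
        (by simp only [mapEdge, edge]; ring))
    have h1 : (shift a ω) (edge (0 + i) (m - 1 - i + r)) = ω (edge (a + i) (m - 1 - i + r)) :=
      congrArg ω h
    rw [excess, excess, h1]
    congr 4
    simp only [edge]
    ring

section Law

variable {p : ℝ} {F : Measure ℝ} [IsProbabilityMeasure F]

lemma measurePreserving_relabel {φ : ℤ → ℤ} (hφ : StrictMono φ) (hp0 : 0 ≤ p) (hp1 : p ≤ 1) :
    MeasurePreserving (relabel φ hφ) (cfgLaw p F) (cfgLaw p F) :=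
  measurePreserving_relabelEdges hp0 hp1 (mapEdge_injective hφ)

lemma identDistrib_blockWt (hp0 : 0 ≤ p) (hp1 : p ≤ 1) (c : ℝ) (a : ℤ) (m : ℕ) :
    IdentDistrib (blockWt c a m) (blockWt c 0 m) (cfgLaw p F) (cfgLaw p F) := by
  refine ⟨(measurable_blockWt c a m).aemeasurable, (measurable_blockWt c 0 m).aemeasurable, ?_⟩
  have h : MeasurePreserving (shift a) (cfgLaw p F) (cfgLaw p F) :=
    measurePreserving_relabel (strictMono_add_int a) hp0 hp1
  have h1 : blockWt c a m = blockWt c 0 m ∘ shift a := funext fun ω => blockWt_eq_shift c a m ω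
  rw [h1, ← Measure.map_map (measurable_blockWt c 0 m) h.measurable, h.map_eq]

lemma indepFun_blockWt (hp0 : 0 ≤ p) (hp1 : p ≤ 1) (c : ℝ) {a a' : ℤ} {m : ℕ}
    (h : a + m ≤ a' ∨ a' + m ≤ a) :
    IndepFun (blockWt c a m) (blockWt c a' m) (cfgLaw p F) := by
  refine cfgLaw_indepFun hp0 hp1 ?_ (measurable_blockWt c a m) (measurable_blockWt c a' m)
    (dependsOn_blockWt c a m) (dependsOn_blockWt c a' m)
  refine Set.disjoint_left.2 fun e he he' => ?_
  simp only [startIn, Set.mem_ofPred_eq] at he he'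
  omega

end Law

/-! ### The mean contribution of the edges that leave a block -/

/-- The mean excess over `c` times its length of an edge of length `l + 1`. -/
noncomputable def meanExcess (F : Measure ℝ) (c : ℝ) (l : ℕ) : ℝ≥0∞ :=
  ∫⁻ x, ENNReal.ofReal (x - c * (l + 1)) ∂F

/-- There are at most `x / c` lengths `l` with `c l < x`. -/
lemma tsum_ofReal_sub_le {c : ℝ} (hc : 0 < c) (x : ℝ) :
    ∑' l : ℕ, ENNReal.ofReal (x - c * (l + 1)) ≤ ENNReal.ofReal (x ^ 2 / c) := by
  rcases le_or_gt x 0 with hx | hx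
  · have : ∀ l : ℕ, ENNReal.ofReal (x - c * (l + 1)) = 0 := fun l =>
      ENNReal.ofReal_of_nonpos (by nlinarith [mul_nonneg hc.le (Nat.cast_nonneg (α := ℝ) l)])
    simp [this]
  rw [tsum_eq_sum (s := Finset.range ⌊x / c⌋₊)]
  · calc ∑ l ∈ Finset.range ⌊x / c⌋₊, ENNReal.ofReal (x - c * (l + 1))
        ≤ ∑ l ∈ Finset.range ⌊x / c⌋₊, ENNReal.ofReal x := by
          refine Finset.sum_le_sum fun l _ => ENNReal.ofReal_le_ofReal ?_
          nlinarith [mul_nonneg hc.le (Nat.cast_nonneg (α := ℝ) l)]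
      _ = ENNReal.ofReal (⌊x / c⌋₊ * x) := by
          rw [Finset.sum_const, Finset.card_range, nsmul_eq_mul,
            ENNReal.ofReal_mul (Nat.cast_nonneg _), ENNReal.ofReal_natCast]
      _ ≤ _ := by
          refine ENNReal.ofReal_le_ofReal ?_
          have := Nat.floor_le (div_nonneg hx.le hc.le)
          calc ⌊x / c⌋₊ * x ≤ x / c * x := by gcongr
            _ = x ^ 2 / c := by ring
  · intro l hl
    refine ENNReal.ofReal_of_nonpos ?_
    have h1 : (⌊x / c⌋₊ : ℝ) ≤ l := by exact_mod_cast (by simpa using hl)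
    have h2 := Nat.lt_floor_add_one (x / c)
    have h3 : x / c < l + 1 := by linarith
    rw [div_lt_iff₀ hc] at h3
    nlinarith

lemma tsum_meanExcess_ne_top {F : Measure ℝ} (hF2 : Integrable (fun x : ℝ => x ^ 2) F) {c : ℝ} (hc : 0 < c) :
    ∑' l, meanExcess F c l ≠ ∞ := by
  unfold meanExcess
  rw [← lintegral_tsum fun l => by fun_prop]
  refine ne_top_of_le_ne_top ?_ (lintegral_mono fun x => tsum_ofReal_sub_le hc x)
  exact (hF2.div_const c).lintegral_lt_top.ne

lemma lintegral_blockWt (p : ℝ) (F : Measure ℝ) (c : ℝ) (m : ℕ) :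
    ∫⁻ ω, blockWt c 0 m ω ∂cfgLaw p F =
      ∫⁻ ω, maxWt 0 m ω ∂cfgLaw p F + ∫⁻ ω, exitExcess c 0 m ω ∂cfgLaw p F := by
  unfold blockWt
  rw [lintegral_add_left (measurable_maxWt _ _), zero_add]

section Moments

variable {p : ℝ} {F : Measure ℝ} [IsProbabilityMeasure F]

lemma lintegral_excess (hp0 : 0 ≤ p) (hp1 : p ≤ 1) (c : ℝ) (x : ℤ) (l : ℕ) :
    ∫⁻ ω, excess c ω (edge x l) ∂cfgLaw p F = meanExcess F c l := by
  have h := lintegral_weight (F := F) hp0 hp1 (edge x l)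
    (f := fun y => ENNReal.ofReal (y - c * (l + 1))) (by fun_prop)
  rw [meanExcess, ← h]
  refine lintegral_congr fun ω => ?_
  rw [excess]
  congr 3
  simp only [edge]
  push_cast
  ring

lemma lintegral_exitExcess (hp0 : 0 ≤ p) (hp1 : p ≤ 1) (c : ℝ) (a : ℤ) (m : ℕ) :
    ∫⁻ ω, exitExcess c a m ω ∂cfgLaw p F =
      ∑ i ∈ Finset.range m, ∑' r : ℕ, meanExcess F c (r + i) := by
  unfold exitExcess
  rw [lintegral_finsetSum _ fun i _ => Measurable.tsum fun r => measurable_excess c _,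
    ← Finset.sum_range_reflect]
  refine Finset.sum_congr rfl fun i hi => ?_
  rw [lintegral_tsum fun r => (measurable_excess c _).aemeasurable]
  refine tsum_congr fun r => ?_
  rw [lintegral_excess hp0 hp1]
  congr 1
  have := Finset.mem_range.1 hi
  omega

lemma lintegral_exitExcess_ne_top (hp0 : 0 ≤ p) (hp1 : p ≤ 1)
    (hF2 : Integrable (fun x : ℝ => x ^ 2) F) {c : ℝ} (hc : 0 < c) (a : ℤ) (m : ℕ) :
    ∫⁻ ω, exitExcess c a m ω ∂cfgLaw p F ≠ ∞ := by
  rw [lintegral_exitExcess hp0 hp1]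
  refine ENNReal.sum_ne_top.2 fun i _ => ne_top_of_le_ne_top (tsum_meanExcess_ne_top hF2 hc) ?_
  exact ENNReal.tsum_comp_le_tsum_of_injective (add_left_injective i) _

/-- The edges leaving a long block have a negligible excess. -/
lemma tendsto_lintegral_exitExcess (hp0 : 0 ≤ p) (hp1 : p ≤ 1)
    (hF2 : Integrable (fun x : ℝ => x ^ 2) F) {c : ℝ} (hc : 0 < c) :
    Tendsto (fun m : ℕ => (∫⁻ ω, exitExcess c 0 m ω ∂cfgLaw p F).toReal / m) atTop (𝓝 0) := by
  have h1 := ENNReal.tendsto_sum_nat_add (meanExcess F c) (tsum_meanExcess_ne_top hF2 hc)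
  have h2 := ((ENNReal.tendsto_toReal ENNReal.zero_ne_top).comp h1).cesaro
  simp only [ENNReal.toReal_zero] at h2
  refine h2.congr fun m => ?_
  rw [lintegral_exitExcess hp0 hp1, ENNReal.toReal_sum, div_eq_inv_mul]
  · rfl
  · exact fun i _ => ne_top_of_le_ne_top (tsum_meanExcess_ne_top hF2 hc)
      (ENNReal.tsum_comp_le_tsum_of_injective (add_left_injective i) _)

/-! ### The mean weight of the best path in a block -/

lemma maxWt_zero_one (ω : Cfg) : maxWt 0 1 ω = 0 := by
  refine le_antisymm (maxWt_le fun i j π hπ => ?_) zero_le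
  cases π with
  | nil => simp
  | cons e π =>
    have h1 := e.2
    have h2 := hπ.1.2.1
    have h3 := hπ.1.2.2
    omega

lemma lintegral_maxWt_mul_le (hp0 : 0 ≤ p) (hp1 : p ≤ 1) {c : ℝ} (hc : 0 ≤ c) {m : ℕ}
    (hm : 0 < m) (k : ℕ) :
    ∫⁻ ω, maxWt 0 (k * m) ω ∂cfgLaw p F ≤
      ENNReal.ofReal (c * (k * m)) + k * ∫⁻ ω, blockWt c 0 m ω ∂cfgLaw p F := by
  have := isProbabilityMeasure_cfgLaw (F := F) hp0 hp1
  refine (lintegral_mono fun ω => maxWt_le_sum_blockWt hc hm k ω).trans ?_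
  rw [lintegral_add_left measurable_const, lintegral_const, measure_univ, mul_one,
    lintegral_finsetSum _ fun b _ => measurable_blockWt c _ m]
  gcongr
  rw [Finset.sum_congr rfl fun (b : ℕ) _ =>
    (identDistrib_blockWt hp0 hp1 c (b * m) m).lintegral_eq]
  simp

lemma lintegral_maxWt_ne_top (hp0 : 0 ≤ p) (hp1 : p ≤ 1)
    (hF2 : Integrable (fun x : ℝ => x ^ 2) F) (n : ℕ) :
    ∫⁻ ω, maxWt 0 n ω ∂cfgLaw p F ≠ ∞ := by
  -- Blocks of length `1` contain no edge.
  have h := lintegral_maxWt_mul_le (F := F) hp0 hp1 zero_le_one one_pos n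
  simp only [Nat.cast_one, mul_one, blockWt, zero_add, maxWt_zero_one, one_mul] at h
  refine ne_top_of_le_ne_top ?_ h
  exact ENNReal.add_ne_top.2 ⟨ENNReal.ofReal_ne_top, ENNReal.mul_ne_top (ENNReal.natCast_ne_top n)
    (lintegral_exitExcess_ne_top hp0 hp1 hF2 one_pos 0 1)⟩

lemma lintegral_blockWt_ne_top (hp0 : 0 ≤ p) (hp1 : p ≤ 1)
    (hF2 : Integrable (fun x : ℝ => x ^ 2) F) {c : ℝ} (hc : 0 < c) (m : ℕ) :
    ∫⁻ ω, blockWt c 0 m ω ∂cfgLaw p F ≠ ∞ := by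
  rw [lintegral_blockWt]
  exact ENNReal.add_ne_top.2 ⟨lintegral_maxWt_ne_top hp0 hp1 hF2 m,
    lintegral_exitExcess_ne_top hp0 hp1 hF2 hc 0 m⟩

end Moments

/-! ### The growth rate of the mean -/

/-- The mean weight of the best path in `[0, n)`. -/
noncomputable def meanWt (p : ℝ) (F : Measure ℝ) (n : ℕ) : ℝ :=
  (∫⁻ ω, maxWt 0 n ω ∂cfgLaw p F).toReal

/-- The upper bound for the growth rate that is obtained from blocks of length `m`. -/
noncomputable def blockRate (p : ℝ) (F : Measure ℝ) (c : ℝ) (m : ℕ) : ℝ :=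
  c + (∫⁻ ω, blockWt c 0 m ω ∂cfgLaw p F).toReal / m

lemma lt_div_add_one_mul {m : ℕ} (hm : 0 < m) (n : ℕ) : n < (n / m + 1) * m :=
  (Nat.div_lt_iff_lt_mul hm).1 (Nat.lt_succ_self _)

/-- Rounding `n` up to a multiple of `m` does not matter in the limit. -/
lemma tendsto_div_add_one_mul_div {m : ℕ} (hm : 0 < m) :
    Tendsto (fun n : ℕ => (((n / m + 1 : ℕ) : ℝ) * m) / n) atTop (𝓝 1) := by
  have h1 : Tendsto (fun n : ℕ => (1 : ℝ) + m / n) atTop (𝓝 1) := by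
    simpa using (tendsto_const_nhds (x := (1 : ℝ))).add
      (tendsto_const_div_atTop_nhds_zero_nat (m : ℝ))
  refine tendsto_of_tendsto_of_tendsto_of_le_of_le' tendsto_const_nhds h1 ?_ ?_
  · filter_upwards [eventually_gt_atTop 0] with n hn
    rw [le_div_iff₀ (by exact_mod_cast hn), one_mul]
    exact_mod_cast (lt_div_add_one_mul hm n).le
  · filter_upwards [eventually_gt_atTop 0] with n hn
    have hn' : (0 : ℝ) < n := by exact_mod_cast hn
    rw [div_le_iff₀ hn', add_mul, one_mul, div_mul_cancel₀ _ hn'.ne']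
    have := Nat.div_mul_le_self n m
    exact_mod_cast (by rw [add_mul, one_mul]; omega)

lemma tendsto_nat_div_add_one {m : ℕ} (hm : 0 < m) :
    Tendsto (fun n : ℕ => n / m + 1) atTop atTop :=
  (tendsto_add_atTop_nat 1).comp (Nat.tendsto_div_const_atTop hm.ne')

lemma meanWt_nonneg (p : ℝ) (F : Measure ℝ) (n : ℕ) : 0 ≤ meanWt p F n := ENNReal.toReal_nonneg

section Mean

variable {p : ℝ} {F : Measure ℝ} [IsProbabilityMeasure F]

lemma maxWt_le_roundUp {m : ℕ} (hm : 0 < m) (n : ℕ) (ω : Cfg) :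
    maxWt 0 n ω ≤ maxWt 0 ((n / m + 1 : ℕ) * m) ω :=
  maxWt_mono le_rfl (by exact_mod_cast (lt_div_add_one_mul hm n).le) ω

lemma meanWt_le (hp0 : 0 ≤ p) (hp1 : p ≤ 1) (hF2 : Integrable (fun x : ℝ => x ^ 2) F) {c : ℝ}
    (hc : 0 < c) {m : ℕ} (hm : 0 < m) (n : ℕ) :
    meanWt p F n ≤ ((n / m + 1 : ℕ) * m) * blockRate p F c m := by
  have h1 := (lintegral_mono (μ := cfgLaw p F) fun ω => maxWt_le_roundUp hm n ω).trans
    (lintegral_maxWt_mul_le hp0 hp1 hc.le hm (n / m + 1))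
  have h2 := lintegral_blockWt_ne_top hp0 hp1 hF2 hc m
  have hm' : (m : ℝ) ≠ 0 := by exact_mod_cast hm.ne'
  have h3 := ENNReal.toReal_mono (ENNReal.add_ne_top.2 ⟨ENNReal.ofReal_ne_top,
    ENNReal.mul_ne_top (ENNReal.natCast_ne_top _) h2⟩) h1
  rw [ENNReal.toReal_add ENNReal.ofReal_ne_top (ENNReal.mul_ne_top (ENNReal.natCast_ne_top _) h2),
    ENNReal.toReal_ofReal (by positivity), ENNReal.toReal_mul, ENNReal.toReal_natCast] at h3
  refine h3.trans_eq ?_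
  rw [blockRate]
  field_simp

/-- Long blocks give upper bounds arbitrarily close to the growth rate. -/
lemma exists_blockRate_lt (hp0 : 0 ≤ p) (hp1 : p ≤ 1) (hF2 : Integrable (fun x : ℝ => x ^ 2) F)
    {C : ℝ} (hC : ∀ ε > 0, ∃ᶠ m : ℕ in atTop, meanWt p F m / m < C + ε) {ε : ℝ} (hε : 0 < ε) :
    ∃ c > 0, ∃ m > 0, blockRate p F c m < C + ε := by
  have hε3 : 0 < ε / 3 := by positivity
  have h1 := (tendsto_lintegral_exitExcess (p := p) hp0 hp1 hF2 hε3).eventually_lt_const hε3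
  obtain ⟨m, h2, h3, h4⟩ := ((hC _ hε3).and_eventually (h1.and (eventually_gt_atTop 0))).exists
  refine ⟨ε / 3, hε3, m, h4, ?_⟩
  rw [blockRate, lintegral_blockWt, ENNReal.toReal_add (lintegral_maxWt_ne_top hp0 hp1 hF2 m)
    (lintegral_exitExcess_ne_top hp0 hp1 hF2 hε3 0 m), add_div]
  rw [meanWt] at h2
  linarith

/-- The mean weight of the best path in `[0, n)` grows linearly. -/
lemma exists_tendsto_meanWt (hp0 : 0 ≤ p) (hp1 : p ≤ 1)
    (hF2 : Integrable (fun x : ℝ => x ^ 2) F) :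
    ∃ C, Tendsto (fun n : ℕ => meanWt p F n / n) atTop (𝓝 C) := by
  have hlim : ∀ (c : ℝ) (m : ℕ), 0 < m → Tendsto (fun n : ℕ =>
      (((n / m + 1 : ℕ) : ℝ) * m) / n * blockRate p F c m) atTop (𝓝 (blockRate p F c m)) := by
    intro c m hm
    simpa using (tendsto_div_add_one_mul_div hm).mul_const (blockRate p F c m)
  have hle : ∀ (c : ℝ) (m : ℕ), 0 < c → 0 < m → ∀ n : ℕ,
      meanWt p F n / n ≤ (((n / m + 1 : ℕ) : ℝ) * m) / n * blockRate p F c m := by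
    intro c m hc hm n
    rw [div_mul_eq_mul_div]
    exact div_le_div_of_nonneg_right (meanWt_le hp0 hp1 hF2 hc hm n) (Nat.cast_nonneg n)
  have hlow : IsBoundedUnder (· ≥ ·) atTop (fun n : ℕ => meanWt p F n / n) :=
    isBoundedUnder_of ⟨0, fun n => div_nonneg (meanWt_nonneg p F n) (Nat.cast_nonneg n)⟩
  have hup : IsBoundedUnder (· ≤ ·) atTop (fun n : ℕ => meanWt p F n / n) :=
    (hlim 1 1 one_pos).isBoundedUnder_le.mono_le
      (Eventually.of_forall (hle 1 1 one_pos one_pos))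
  set C := liminf (fun n : ℕ => meanWt p F n / n) atTop with hC
  refine ⟨C, tendsto_order.2 ⟨fun a ha => eventually_lt_of_lt_liminf ha hlow, fun a ha => ?_⟩⟩
  obtain ⟨c, hc, m, hm, h⟩ := exists_blockRate_lt hp0 hp1 hF2 (C := C) (fun ε hε =>
    frequently_lt_of_liminf_lt hup.isCoboundedUnder_ge (by linarith)) (sub_pos.2 ha)
  filter_upwards [(hlim c m hm).eventually_lt_const (by linarith : blockRate p F c m < a)]
    with n hn
  exact (hle c m hc hm n).trans_lt hn

/-! ### The growth rate is positive -/

/-- The map of vertices that skips the vertex `1`. -/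
def skipOne (x : ℤ) : ℤ := if x ≤ 0 then x else x + 1

lemma strictMono_skipOne : StrictMono skipOne := fun x y h => by
  unfold skipOne
  split_ifs <;> omega

lemma maxFrom_skipOne_le (n : ℕ) (ω : Cfg) :
    maxFrom 0 n 0 (relabel skipOne strictMono_skipOne ω) ≤ maxFrom 0 (n + 1 : ℕ) 0 ω :=
  maxFrom_relabel_le strictMono_skipOne ω
    (by intro x _ _; unfold skipOne; push_cast; split_ifs <;> constructor <;> omega) 0

lemma wt_add_maxFrom_shift_le {n : ℕ} (hn : 1 ≤ n) {ω : Cfg} (h : (ω (edge 0 0)).1 = true) :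
    wt ω (edge 0 0) + maxFrom 0 n 0 (shift 1 ω) ≤ maxFrom 0 (n + 1 : ℕ) 0 ω := by
  have h1 := maxFrom_relabel_le (strictMono_add_int 1) ω (a := 0) (b := n) (a' := 0)
    (b' := (n + 1 : ℕ)) (by intro x _ _; push_cast; constructor <;> omega) 0
  refine (add_le_add_right h1 _).trans ?_
  exact wt_add_maxFrom_le (e := edge 0 0) ⟨h, le_rfl, by simp only [edge]; push_cast; omega⟩

/-- Adding a vertex to the interval adds at least `p 𝔼[v]` to the mean of the best weight of a path
from the left end: if the edge `(0, 1)` is present, use it and go on from `1`; otherwise skip the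
vertex `1`, which leaves a graph with the law of the original one. -/
lemma lintegral_maxFrom_succ (hp0 : 0 ≤ p) (hp1 : p ≤ 1) {n : ℕ} (hn : 1 ≤ n) :
    ENNReal.ofReal p * ∫⁻ x, ENNReal.ofReal x ∂F + ∫⁻ ω, maxFrom 0 n 0 ω ∂cfgLaw p F ≤
      ∫⁻ ω, maxFrom 0 (n + 1 : ℕ) 0 ω ∂cfgLaw p F := by
  have := isProbabilityMeasure_cfgLaw (F := F) hp0 hp1
  set V := ∫⁻ ω, maxFrom 0 n 0 ω ∂cfgLaw p F with hV
  -- The relabelled configuration does not see the edge `(0, 1)`.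
  have key : ∀ (φ : ℤ → ℤ) (hφ : StrictMono φ), (∀ e ∈ inside 0 n, mapEdge φ hφ e ≠ edge 0 0) →
      ∀ b : Bool,
      ∫⁻ ω in {ω : Cfg | (ω (edge 0 0)).1 = b}, maxFrom 0 n 0 (relabel φ hφ ω) ∂cfgLaw p F =
        cfgLaw p F {ω : Cfg | (ω (edge 0 0)).1 = b} * V := by
    intro φ hφ hne b
    have hmp := measurePreserving_relabel (F := F) hφ hp0 hp1
    have hS := measurableSet_present (edge 0 0) b
    have hind : IndepFun ({ω : Cfg | (ω (edge 0 0)).1 = b}.indicator (fun _ => (1 : ℝ≥0∞)))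
        (fun ω => maxFrom 0 n 0 (relabel φ hφ ω)) (cfgLaw p F) := by
      refine cfgLaw_indepFun hp0 hp1 (S := {edge 0 0}) (T := {edge 0 0}ᶜ) disjoint_compl_right
        (measurable_const.indicator hS) ((measurable_maxFrom _ _ _).comp hmp.measurable) ?_ ?_
      · intro ω ω' h
        simp only [Set.indicator, Set.mem_ofPred_eq, h (edge 0 0) rfl]
      · intro ω ω' h
        exact dependsOn_maxFrom 0 n 0 fun e he => h _ (hne e he)
    have h1 := lintegral_mul_eq_lintegral_mul_lintegral_of_indepFun
      (measurable_const.indicator hS) ((measurable_maxFrom 0 n 0).comp hmp.measurable) hind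
    rw [lintegral_indicator_const hS, one_mul] at h1
    rw [hV, ← hmp.lintegral_comp (measurable_maxFrom 0 n 0), ← lintegral_indicator hS]
    refine Eq.trans (lintegral_congr fun ω => ?_) h1
    by_cases h : ω ∈ {ω : Cfg | (ω (edge 0 0)).1 = b} <;> simp [h]
  have hne1 : ∀ e ∈ inside 0 n, mapEdge (· + 1) (strictMono_add_int 1) e ≠ edge 0 0 := by
    intro e he h
    have h1 : e.1.1 + 1 = 0 := congrArg (fun x : Edge => x.1.1) h
    have h2 := he.1
    omega
  have hne2 : ∀ e ∈ inside 0 n, mapEdge skipOne strictMono_skipOne e ≠ edge 0 0 := by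
    intro e _ h
    have h1 : skipOne e.1.2 = 0 + 1 + (0 : ℕ) := congrArg (fun x : Edge => x.1.2) h
    unfold skipOne at h1
    split_ifs at h1 <;> push_cast at h1 <;> omega
  have hS := measurableSet_present (edge 0 0) true
  have hcompl : {ω : Cfg | (ω (edge 0 0)).1 = true}ᶜ = {ω : Cfg | (ω (edge 0 0)).1 = false} := by
    ext ω
    simp
  have hV1 : V = ENNReal.ofReal p * V + ENNReal.ofReal (1 - p) * V := by
    rw [← add_mul, ← ENNReal.ofReal_add hp0 (by linarith)]
    simp
  rw [← lintegral_add_compl (fun ω => maxFrom 0 (n + 1 : ℕ) 0 ω) hS, hcompl, hV1, ← add_assoc]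
  refine add_le_add ?_ ?_
  · have h1 := key _ (strictMono_add_int 1) hne1 true
    rw [cfgLaw_present hp0 hp1] at h1
    rw [← h1, ← lintegral_present_weight hp0 hp1 (edge 0 0) ENNReal.measurable_ofReal,
      ← lintegral_add_left
        (show Measurable fun ω : Cfg => ENNReal.ofReal (ω (edge 0 0)).2 from measurable_wt _)]
    exact setLIntegral_mono (measurable_maxFrom _ _ _) fun ω hω => wt_add_maxFrom_shift_le hn hω
  · have h1 := key _ strictMono_skipOne hne2 false
    rw [cfgLaw_absent hp0 hp1] at h1
    rw [← h1]
    exact setLIntegral_mono (measurable_maxFrom _ _ _) fun ω _ => maxFrom_skipOne_le n ω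

lemma mul_le_lintegral_maxWt (hp0 : 0 ≤ p) (hp1 : p ≤ 1) (n : ℕ) :
    n * (ENNReal.ofReal p * ∫⁻ x, ENNReal.ofReal x ∂F) ≤
      ∫⁻ ω, maxWt 0 (n + 1 : ℕ) ω ∂cfgLaw p F := by
  refine le_trans ?_ (lintegral_mono fun ω => maxFrom_le_maxWt 0 (n + 1 : ℕ) 0 ω)
  induction n with
  | zero => simp
  | succ n ih =>
    refine le_trans ?_ (lintegral_maxFrom_succ hp0 hp1 (Nat.succ_pos n))
    rw [Nat.cast_succ, add_mul, one_mul, add_comm]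
    gcongr

lemma lintegral_ofReal_pos (hFpos : ∀ᵐ x ∂F, 0 < x) : 0 < ∫⁻ x, ENNReal.ofReal x ∂F := by
  rw [lintegral_pos_iff_support ENNReal.measurable_ofReal]
  have h : F (Function.support fun x : ℝ => ENNReal.ofReal x) = 1 := by
    rw [← prob_compl_eq_zero_iff (measurableSet_support ENNReal.measurable_ofReal)]
    filter_upwards [hFpos] with x hx
    simp [hx]
  rw [h]
  exact one_pos

lemma growthRate_pos (hp0 : 0 < p) (hp1 : p ≤ 1) (hFpos : ∀ᵐ x ∂F, 0 < x)
    (hF2 : Integrable (fun x : ℝ => x ^ 2) F) {C : ℝ}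
    (hC : Tendsto (fun n : ℕ => meanWt p F n / n) atTop (𝓝 C)) : 0 < C := by
  set d : ℝ≥0∞ := ENNReal.ofReal p * ∫⁻ x, ENNReal.ofReal x ∂F with hd
  have hd0 : d ≠ 0 := mul_ne_zero (by simpa using hp0) (lintegral_ofReal_pos hFpos).ne'
  have hdt : d ≠ ∞ := by
    refine ne_top_of_le_ne_top (lintegral_maxWt_ne_top hp0.le hp1 hF2 2) ?_
    simpa using mul_le_lintegral_maxWt (F := F) hp0.le hp1 1
  have hd' : 0 < d.toReal := ENNReal.toReal_pos hd0 hdt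
  have h1 : Tendsto (fun n : ℕ => meanWt p F (n + 1) / (n + 1 : ℕ)) atTop (𝓝 C) :=
    hC.comp (tendsto_add_atTop_nat 1)
  have h2 : d.toReal / 2 ≤ C := by
    refine ge_of_tendsto h1 ?_
    filter_upwards [eventually_ge_atTop 1] with n hn
    have h3 := ENNReal.toReal_mono (lintegral_maxWt_ne_top hp0.le hp1 hF2 (n + 1))
      (mul_le_lintegral_maxWt (F := F) hp0.le hp1 n)
    rw [ENNReal.toReal_mul, ENNReal.toReal_natCast] at h3
    have hn' : (1 : ℝ) ≤ n := by exact_mod_cast hn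
    rw [le_div_iff₀ (by positivity)]
    refine le_trans ?_ h3
    push_cast
    nlinarith
  linarith

end Mean

/-! ### The upper bound, almost surely and in mean -/

/-- The contribution of the `b`-th block of length `m`, as a real number. -/
noncomputable def blockVar (c : ℝ) (m b : ℕ) (ω : Cfg) : ℝ := (blockWt c (b * m) m ω).toReal

/-- The upper bound for the weight of the best path in `[0, n)`, divided by `n`, that is obtained
from blocks of length `m`. -/
noncomputable def blockBound (c : ℝ) (m n : ℕ) (ω : Cfg) : ℝ :=
  (((n / m + 1 : ℕ) : ℝ) * m) / n *
    (c + ((n / m + 1 : ℕ) : ℝ)⁻¹ • (∑ b ∈ Finset.range (n / m + 1), blockVar c m b ω) / m)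

section Upper

variable {p : ℝ} {F : Measure ℝ} [IsProbabilityMeasure F]

lemma identDistrib_blockVar (hp0 : 0 ≤ p) (hp1 : p ≤ 1) (c : ℝ) (m b : ℕ) :
    IdentDistrib (blockVar c m b) (blockVar c m 0) (cfgLaw p F) (cfgLaw p F) := by
  have h := ((identDistrib_blockWt (F := F) hp0 hp1 c (b * m) m).trans
    (identDistrib_blockWt hp0 hp1 c ((0 : ℕ) * m) m).symm).comp ENNReal.measurable_toReal
  exact h

lemma indepFun_blockVar (hp0 : 0 ≤ p) (hp1 : p ≤ 1) (c : ℝ) (m : ℕ) {b b' : ℕ} (h : b ≠ b') :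
    IndepFun (blockVar c m b) (blockVar c m b') (cfgLaw p F) := by
  refine (indepFun_blockWt hp0 hp1 c ?_).comp ENNReal.measurable_toReal ENNReal.measurable_toReal
  have key : ∀ x y : ℕ, x < y → (x * m + m : ℤ) ≤ y * m := fun x y hxy => by
    have : (x + 1) * m ≤ y * m := Nat.mul_le_mul_right m hxy
    rw [add_mul, one_mul] at this
    exact_mod_cast this
  rcases lt_or_gt_of_ne h with h | h
  · exact Or.inl (key _ _ h)
  · exact Or.inr (key _ _ h)

lemma ae_blockWt_lt_top (hp0 : 0 ≤ p) (hp1 : p ≤ 1) (hF2 : Integrable (fun x : ℝ => x ^ 2) F)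
    {c : ℝ} (hc : 0 < c) (m : ℕ) :
    ∀ᵐ ω ∂cfgLaw p F, ∀ b : ℕ, blockWt c (b * m) m ω < ∞ := by
  refine ae_all_iff.2 fun b => ae_lt_top (measurable_blockWt _ _ _) ?_
  rw [(identDistrib_blockWt hp0 hp1 c (b * m) m).lintegral_eq]
  exact lintegral_blockWt_ne_top hp0 hp1 hF2 hc m

lemma integrable_blockVar (hp0 : 0 ≤ p) (hp1 : p ≤ 1) (hF2 : Integrable (fun x : ℝ => x ^ 2) F)
    {c : ℝ} (hc : 0 < c) (m b : ℕ) : Integrable (blockVar c m b) (cfgLaw p F) := by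
  refine integrable_toReal_of_lintegral_ne_top (measurable_blockWt _ _ _).aemeasurable ?_
  rw [(identDistrib_blockWt hp0 hp1 c (b * m) m).lintegral_eq]
  exact lintegral_blockWt_ne_top hp0 hp1 hF2 hc m

lemma integral_blockVar (hp0 : 0 ≤ p) (hp1 : p ≤ 1) (hF2 : Integrable (fun x : ℝ => x ^ 2) F)
    {c : ℝ} (hc : 0 < c) (m : ℕ) :
    ∫ ω, blockVar c m 0 ω ∂cfgLaw p F = (∫⁻ ω, blockWt c 0 m ω ∂cfgLaw p F).toReal := by
  have h : blockVar c m 0 = fun ω => (blockWt c 0 m ω).toReal := by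
    funext ω
    simp [blockVar]
  rw [h]
  refine integral_toReal (measurable_blockWt _ _ _).aemeasurable ?_
  exact ae_lt_top (measurable_blockWt _ _ _) (lintegral_blockWt_ne_top hp0 hp1 hF2 hc m)

lemma integrable_maxWt (hp0 : 0 ≤ p) (hp1 : p ≤ 1) (hF2 : Integrable (fun x : ℝ => x ^ 2) F)
    (n : ℕ) : Integrable (fun ω => (maxWt 0 n ω).toReal) (cfgLaw p F) :=
  integrable_toReal_of_lintegral_ne_top (measurable_maxWt _ _).aemeasurable
    (lintegral_maxWt_ne_top hp0 hp1 hF2 n)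

lemma ae_maxWt_lt_top (hp0 : 0 ≤ p) (hp1 : p ≤ 1) (hF2 : Integrable (fun x : ℝ => x ^ 2) F) :
    ∀ᵐ ω ∂cfgLaw p F, ∀ n : ℕ, maxWt 0 n ω < ∞ :=
  ae_all_iff.2 fun n => ae_lt_top (measurable_maxWt _ _) (lintegral_maxWt_ne_top hp0 hp1 hF2 n)

lemma integral_maxWt (hp0 : 0 ≤ p) (hp1 : p ≤ 1) (hF2 : Integrable (fun x : ℝ => x ^ 2) F)
    (n : ℕ) : ∫ ω, (maxWt 0 n ω).toReal ∂cfgLaw p F = meanWt p F n :=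
  integral_toReal (measurable_maxWt _ _).aemeasurable
    (ae_lt_top (measurable_maxWt _ _) (lintegral_maxWt_ne_top hp0 hp1 hF2 n))

lemma ae_maxWt_div_le_blockBound (hp0 : 0 ≤ p) (hp1 : p ≤ 1)
    (hF2 : Integrable (fun x : ℝ => x ^ 2) F) {c : ℝ} (hc : 0 < c) {m : ℕ} (hm : 0 < m) :
    ∀ᵐ ω ∂cfgLaw p F, ∀ n : ℕ, (maxWt 0 n ω).toReal / n ≤ blockBound c m n ω := by
  filter_upwards [ae_blockWt_lt_top hp0 hp1 hF2 hc m] with ω hω n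
  have h1 := (maxWt_le_roundUp hm n ω).trans (maxWt_le_sum_blockWt hc.le hm (n / m + 1) ω)
  have h2 : ∑ b ∈ Finset.range (n / m + 1), blockWt c (b * m) m ω ≠ ∞ :=
    ENNReal.sum_ne_top.2 fun b _ => (hω b).ne
  have h3 := ENNReal.toReal_mono (ENNReal.add_ne_top.2 ⟨ENNReal.ofReal_ne_top, h2⟩) h1
  rw [ENNReal.toReal_add ENNReal.ofReal_ne_top h2, ENNReal.toReal_ofReal (by positivity),
    ENNReal.toReal_sum fun b _ => (hω b).ne] at h3
  have hm' : (m : ℝ) ≠ 0 := by exact_mod_cast hm.ne'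
  have hk : ((n / m + 1 : ℕ) : ℝ) ≠ 0 := by positivity
  rw [blockBound, div_mul_eq_mul_div]
  refine div_le_div_of_nonneg_right (h3.trans_eq ?_) (Nat.cast_nonneg n)
  simp only [blockVar, smul_eq_mul]
  field_simp

lemma tendsto_blockBound_of_tendsto {c : ℝ} {m : ℕ} (hm : 0 < m) {ω : Cfg} {y : ℝ}
    (h : Tendsto (fun k : ℕ => (k : ℝ)⁻¹ • ∑ b ∈ Finset.range k, blockVar c m b ω) atTop (𝓝 y)) :
    Tendsto (fun n => blockBound c m n ω) atTop (𝓝 (c + y / m)) := by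
  have h1 := (h.comp (tendsto_nat_div_add_one hm)).div_const (m : ℝ)
  have h2 := (tendsto_div_add_one_mul_div hm).mul (h1.const_add c)
  rw [one_mul] at h2
  exact h2

lemma ae_tendsto_blockBound (hp0 : 0 ≤ p) (hp1 : p ≤ 1)
    (hF2 : Integrable (fun x : ℝ => x ^ 2) F) {c : ℝ} (hc : 0 < c) {m : ℕ} (hm : 0 < m) :
    ∀ᵐ ω ∂cfgLaw p F,
      Tendsto (fun n => blockBound c m n ω) atTop (𝓝 (blockRate p F c m)) := by
  have := isProbabilityMeasure_cfgLaw (F := F) hp0 hp1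
  filter_upwards [strong_law_ae (blockVar c m) (integrable_blockVar (F := F) hp0 hp1 hF2 hc m 0)
    (fun _ _ h => indepFun_blockVar hp0 hp1 c m h) (identDistrib_blockVar hp0 hp1 c m)] with ω hω
  rw [blockRate, ← integral_blockVar hp0 hp1 hF2 hc m]
  exact tendsto_blockBound_of_tendsto hm hω

lemma integrable_average_blockVar (hp0 : 0 ≤ p) (hp1 : p ≤ 1)
    (hF2 : Integrable (fun x : ℝ => x ^ 2) F) {c : ℝ} (hc : 0 < c) (m k : ℕ) :
    Integrable (fun ω => (k : ℝ)⁻¹ • ∑ b ∈ Finset.range k, blockVar c m b ω) (cfgLaw p F) := by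
  simp only [smul_eq_mul]
  exact (integrable_finsetSum _ fun b _ => integrable_blockVar hp0 hp1 hF2 hc m b).const_mul _

lemma integrable_blockBound (hp0 : 0 ≤ p) (hp1 : p ≤ 1)
    (hF2 : Integrable (fun x : ℝ => x ^ 2) F) {c : ℝ} (hc : 0 < c) (m n : ℕ) :
    Integrable (blockBound c m n) (cfgLaw p F) := by
  have := isProbabilityMeasure_cfgLaw (F := F) hp0 hp1
  exact ((integrable_const c).add
    ((integrable_average_blockVar hp0 hp1 hF2 hc m _).div_const _)).const_mul _

lemma tendsto_integral_abs_blockBound (hp0 : 0 ≤ p) (hp1 : p ≤ 1)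
    (hF2 : Integrable (fun x : ℝ => x ^ 2) F) {c : ℝ} (hc : 0 < c) {m : ℕ} (hm : 0 < m) :
    Tendsto (fun n => ∫ ω, |blockBound c m n ω - blockRate p F c m| ∂cfgLaw p F) atTop (𝓝 0) := by
  have := isProbabilityMeasure_cfgLaw (F := F) hp0 hp1
  have hint := fun b => integrable_blockVar (F := F) hp0 hp1 hF2 hc m b
  set y := ∫ ω, blockVar c m 0 ω ∂cfgLaw p F with hy
  have h1 := strong_law_Lp (p := 1) le_rfl ENNReal.one_ne_top (blockVar c m)
    (memLp_one_iff_integrable.2 (hint 0))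
    (fun _ _ h => indepFun_blockVar hp0 hp1 c m h) (identDistrib_blockVar hp0 hp1 c m)
  -- The strong law of large numbers in `L¹`, in terms of a Bochner integral.
  have h2 : Tendsto (fun k : ℕ => ∫ ω, |(k : ℝ)⁻¹ • ∑ b ∈ Finset.range k, blockVar c m b ω - y|
      ∂cfgLaw p F) atTop (𝓝 0) := by
    have h3 := (ENNReal.tendsto_toReal ENNReal.zero_ne_top).comp h1
    simp only [ENNReal.toReal_zero] at h3
    refine h3.congr fun k => ?_
    rw [Function.comp_apply, eLpNorm_one_eq_lintegral_enorm, ← integral_norm_eq_lintegral_enorm]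
    · rfl
    · exact ((integrable_average_blockVar hp0 hp1 hF2 hc m k).sub
        (integrable_const _)).aestronglyMeasurable
  have hrate : blockRate p F c m = c + y / m := by
    rw [blockRate, hy, integral_blockVar hp0 hp1 hF2 hc m]
  set r : ℕ → ℝ := fun n => (((n / m + 1 : ℕ) : ℝ) * m) / n with hr
  have hr1 : Tendsto r atTop (𝓝 1) := tendsto_div_add_one_mul_div hm
  have h4 := (hr1.div_const (m : ℝ)).mul (h2.comp (tendsto_nat_div_add_one hm))
  have h5 := ((hr1.sub_const 1).abs).mul_const |c + y / m|
  have h6 := h4.add h5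
  simp only [sub_self, abs_zero, zero_mul, mul_zero, add_zero] at h6
  refine squeeze_zero (fun n => integral_nonneg fun ω => abs_nonneg _) (fun n => ?_) h6
  have hav : Integrable (fun ω => |((n / m + 1 : ℕ) : ℝ)⁻¹ •
      ∑ b ∈ Finset.range (n / m + 1), blockVar c m b ω - y|) (cfgLaw p F) :=
    ((integrable_average_blockVar hp0 hp1 hF2 hc m _).sub (integrable_const _)).abs
  calc ∫ ω, |blockBound c m n ω - blockRate p F c m| ∂cfgLaw p F
      ≤ ∫ ω, (r n / m * |((n / m + 1 : ℕ) : ℝ)⁻¹ •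
          ∑ b ∈ Finset.range (n / m + 1), blockVar c m b ω - y| + |r n - 1| * |c + y / m|)
          ∂cfgLaw p F := by
        refine integral_mono ((integrable_blockBound hp0 hp1 hF2 hc m n).sub
          (integrable_const _)).abs ((hav.const_mul _).add (integrable_const _)) fun ω => ?_
        set z := ((n / m + 1 : ℕ) : ℝ)⁻¹ • ∑ b ∈ Finset.range (n / m + 1), blockVar c m b ω with hz
        have hrm : 0 ≤ r n / m := by positivity
        have h7 : blockBound c m n ω - blockRate p F c m =
            r n / m * (z - y) + (r n - 1) * (c + y / m) := by
          rw [hrate]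
          change r n * (c + z / m) - _ = _
          ring
        simp only [h7]
        refine (abs_add_le _ _).trans ?_
        rw [abs_mul, abs_mul, abs_of_nonneg hrm]
    _ = _ := by
        rw [integral_add (hav.const_mul _) (integrable_const _), integral_const_mul]
        simp

/-- Almost surely, the upper growth rate is at most the growth rate of the mean. -/
lemma ae_eventually_maxWt_div_lt (hp0 : 0 ≤ p) (hp1 : p ≤ 1)
    (hF2 : Integrable (fun x : ℝ => x ^ 2) F) {C : ℝ}
    (hC : Tendsto (fun n : ℕ => meanWt p F n / n) atTop (𝓝 C)) {ε : ℝ} (hε : 0 < ε) :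
    ∀ᵐ ω ∂cfgLaw p F, ∀ᶠ n : ℕ in atTop, (maxWt 0 n ω).toReal / n < C + ε := by
  obtain ⟨c, hc, m, hm, h⟩ := exists_blockRate_lt (p := p) hp0 hp1 hF2 (C := C) (fun δ hδ =>
    (hC.eventually_lt_const (by linarith)).frequently) hε
  filter_upwards [ae_maxWt_div_le_blockBound hp0 hp1 hF2 hc hm,
    ae_tendsto_blockBound hp0 hp1 hF2 hc hm] with ω h1 h2
  filter_upwards [h2.eventually_lt_const h] with n hn
  exact (h1 n).trans_lt hn

/-- Convergence in `L¹` of the normalized weight of the best path in `[0, n)`: its mean converges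
to `C`, and the positive part of its difference to `C` is small in `L¹` by the upper bound. -/
lemma tendsto_integral_abs_maxWt (hp0 : 0 ≤ p) (hp1 : p ≤ 1)
    (hF2 : Integrable (fun x : ℝ => x ^ 2) F) {C : ℝ}
    (hC : Tendsto (fun n : ℕ => meanWt p F n / n) atTop (𝓝 C)) :
    Tendsto (fun n : ℕ => ∫ ω, |(maxWt 0 n ω).toReal / n - C| ∂cfgLaw p F) atTop (𝓝 0) := by
  have := isProbabilityMeasure_cfgLaw (F := F) hp0 hp1
  refine tendsto_order.2 ⟨fun a ha => Eventually.of_forall fun n =>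
    ha.trans_le (integral_nonneg fun ω => abs_nonneg _), fun ε hε => ?_⟩
  obtain ⟨c, hc, m, hm, h⟩ := exists_blockRate_lt (p := p) hp0 hp1 hF2 (C := C) (fun δ hδ =>
    (hC.eventually_lt_const (by linarith)).frequently) (show 0 < ε / 8 by positivity)
  have h1 := (tendsto_integral_abs_blockBound (p := p) hp0 hp1 hF2 hc hm).eventually_lt_const
    (show 0 < ε / 8 by positivity)
  have h2 := hC.eventually_const_lt (show C - ε / 4 < C by linarith)
  filter_upwards [h1, h2] with n hn1 hn2
  have hX : Integrable (fun ω => (maxWt 0 n ω).toReal / n - C) (cfgLaw p F) :=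
    ((integrable_maxWt hp0 hp1 hF2 n).div_const (n : ℝ)).sub (integrable_const _)
  have hA : Integrable (fun ω => |blockBound c m n ω - blockRate p F c m|) (cfgLaw p F) :=
    ((integrable_blockBound (p := p) hp0 hp1 hF2 hc m n).sub
    (integrable_const (blockRate p F c m))).abs
  calc ∫ ω, |(maxWt 0 n ω).toReal / n - C| ∂cfgLaw p F
      ≤ ∫ ω, (2 * (|blockBound c m n ω - blockRate p F c m| + ε / 8) -
          ((maxWt 0 n ω).toReal / n - C)) ∂cfgLaw p F := by
        refine integral_mono_ae hX.abs
          (((hA.add (integrable_const _)).const_mul 2).sub hX) ?_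
        filter_upwards [ae_maxWt_div_le_blockBound hp0 hp1 hF2 hc hm] with ω hω
        have h3 := hω n
        have h4 := le_abs_self (blockBound c m n ω - blockRate p F c m)
        have h5 := abs_nonneg (blockBound c m n ω - blockRate p F c m)
        rcases abs_cases ((maxWt 0 n ω).toReal / n - C) with h6 | h6 <;> linarith
    _ = 2 * (∫ ω, |blockBound c m n ω - blockRate p F c m| ∂cfgLaw p F + ε / 8) -
          (meanWt p F n / n - C) := by
        have hA2 : Integrable (fun ω => 2 * (|blockBound c m n ω - blockRate p F c m| + ε / 8))
            (cfgLaw p F) := (hA.add (integrable_const _)).const_mul 2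
        rw [integral_sub hA2 hX, integral_const_mul, integral_add hA (integrable_const _),
          integral_sub ((integrable_maxWt hp0 hp1 hF2 n).div_const (n : ℝ)) (integrable_const _),
          integral_div (n : ℝ), integral_maxWt hp0 hp1 hF2]
        simp
    _ < ε := by linarith

/-- The best path in a long interval is unlikely to be much lighter than it is in the mean. -/
lemma tendsto_measure_maxWt_le (hp0 : 0 ≤ p) (hp1 : p ≤ 1)
    (hF2 : Integrable (fun x : ℝ => x ^ 2) F) {C : ℝ}
    (hC : Tendsto (fun n : ℕ => meanWt p F n / n) atTop (𝓝 C)) {x : ℝ} (hx0 : 0 ≤ x)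
    (hx : x < C) :
    Tendsto (fun n : ℕ => cfgLaw p F {ω | maxWt 0 n ω ≤ ENNReal.ofReal (x * n)})
      atTop (𝓝 0) := by
  have := isProbabilityMeasure_cfgLaw (F := F) hp0 hp1
  have hd : 0 < C - x := sub_pos.2 hx
  have h1 := (tendsto_integral_abs_maxWt (p := p) hp0 hp1 hF2 hC).div_const (C - x)
  rw [zero_div] at h1
  have h2 := ENNReal.tendsto_ofReal h1
  rw [ENNReal.ofReal_zero] at h2
  refine tendsto_of_tendsto_of_tendsto_of_le_of_le' tendsto_const_nhds h2
    (Eventually.of_forall fun _ => zero_le) ?_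
  filter_upwards [eventually_gt_atTop 0] with n hn
  have hn' : (0 : ℝ) < n := by exact_mod_cast hn
  have hX : Integrable (fun ω => |(maxWt 0 n ω).toReal / n - C|) (cfgLaw p F) :=
    (((integrable_maxWt hp0 hp1 hF2 n).div_const (n : ℝ)).sub (integrable_const _)).abs
  have h3 := mul_meas_ge_le_integral_of_nonneg (Eventually.of_forall fun ω => abs_nonneg _) hX
    (C - x)
  have h4 : cfgLaw p F {ω | maxWt 0 n ω ≤ ENNReal.ofReal (x * n)} ≤
      cfgLaw p F {ω | C - x ≤ |(maxWt 0 n ω).toReal / n - C|} := by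
    refine measure_mono fun ω hω => ?_
    have h5 := ENNReal.toReal_mono ENNReal.ofReal_ne_top hω
    rw [ENNReal.toReal_ofReal (by positivity)] at h5
    have h6 : (maxWt 0 n ω).toReal / n ≤ x := (div_le_iff₀ hn').2 h5
    have h7 := neg_abs_le ((maxWt 0 n ω).toReal / n - C)
    simp only [Set.mem_ofPred_eq]
    linarith
  refine h4.trans ?_
  rw [← ofReal_measureReal]
  refine ENNReal.ofReal_le_ofReal ?_
  rw [le_div_iff₀ hd, mul_comm]
  exact h3

end Upper

/-! ### Connections by two edges -/

/-- `Linked ω u d`: there is a path of two edges from `u` to `u + d`, through the vertex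
`u + 1 + l`. It is false for `d ≤ 1`, when there is no vertex in between. -/
def Linked (ω : Cfg) (u : ℤ) (d : ℕ) : Prop :=
  ∃ l < d - 1, (ω (edge u l)).1 = true ∧ (ω (edge (u + 1 + l) (d - 2 - l))).1 = true

lemma Linked.exists_isPath {ω : Cfg} {u : ℤ} {d : ℕ} (h : Linked ω u d) :
    ∃ π, IsPath (openEdges ω) u (u + d) π := by
  obtain ⟨l, hl, h1, h2⟩ := h
  refine ⟨[edge u l, edge (u + 1 + l) (d - 2 - l)], h1, rfl, h2, rfl, ?_⟩
  simp only [IsPath, edge]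
  omega

/-- The `l`-th intermediate vertex does not link `u` to `u + d`. -/
def unlinkedAt (u : ℤ) (d l : ℕ) : Set Cfg :=
  {ω | ¬ ((ω (edge u l)).1 = true ∧ (ω (edge (u + 1 + l) (d - 2 - l))).1 = true)}

lemma measurableSet_unlinkedAt (u : ℤ) (d l : ℕ) : MeasurableSet (unlinkedAt u d l) :=
  ((measurableSet_present _ true).inter (measurableSet_present _ true)).compl

section Links

variable {p : ℝ} {F : Measure ℝ} [IsProbabilityMeasure F]

/-- Events that are determined by disjoint sets of edges are independent. -/
lemma cfgLaw_inter (hp0 : 0 ≤ p) (hp1 : p ≤ 1) {A B : Set Cfg} {S T : Set Edge}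
    (hST : Disjoint S T) (hA : MeasurableSet A) (hB : MeasurableSet B)
    (hAS : DependsOn (fun ω => ω ∈ A) S) (hBT : DependsOn (fun ω => ω ∈ B) T) :
    cfgLaw p F (A ∩ B) = cfgLaw p F A * cfgLaw p F B := by
  have h := cfgLaw_indepFun (F := F) hp0 hp1 hST (measurable_mem.2 hA) (measurable_mem.2 hB)
    hAS hBT
  have h1 := h.measure_inter_preimage_eq_mul {True} {True} (measurableSet_singleton _)
    (measurableSet_singleton _)
  have h2 : ∀ A : Set Cfg, (fun ω => ω ∈ A) ⁻¹' {True} = A := fun A => by ext; simp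
  rwa [h2, h2] at h1

lemma cfgLaw_unlinkedAt (hp0 : 0 ≤ p) (hp1 : p ≤ 1) (u : ℤ) (d l : ℕ) :
    cfgLaw p F (unlinkedAt u d l) = ENNReal.ofReal (1 - p ^ 2) := by
  have := isProbabilityMeasure_cfgLaw (F := F) hp0 hp1
  have h1 : cfgLaw p F ({ω | (ω (edge u l)).1 = true} ∩
      {ω | (ω (edge (u + 1 + l) (d - 2 - l))).1 = true}) = ENNReal.ofReal p * ENNReal.ofReal p := by
    rw [cfgLaw_inter hp0 hp1 (S := {edge u l}) (T := {edge (u + 1 + l) (d - 2 - l)}) ?_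
      (measurableSet_present _ _) (measurableSet_present _ _) ?_ ?_, cfgLaw_present hp0 hp1,
      cfgLaw_present hp0 hp1]
    · rw [Set.disjoint_singleton]
      intro h
      have : u = u + 1 + l := congrArg (fun x : Edge => x.1.1) h
      omega
    · exact fun ω ω' h => by simp only [Set.mem_ofPred_eq, h _ rfl]
    · exact fun ω ω' h => by simp only [Set.mem_ofPred_eq, h _ rfl]
  have h2 : unlinkedAt u d l = ({ω | (ω (edge u l)).1 = true} ∩
      {ω | (ω (edge (u + 1 + l) (d - 2 - l))).1 = true})ᶜ := rfl
  rw [h2, prob_compl_eq_one_sub ((measurableSet_present _ _).inter (measurableSet_present _ _)),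
    h1, ← ENNReal.ofReal_mul hp0, ENNReal.ofReal_sub _ (by positivity), ENNReal.ofReal_one, sq]

/-- The different intermediate vertices provide independent chances to link `u` to `u + d`. -/
lemma cfgLaw_iInter_unlinkedAt (hp0 : 0 ≤ p) (hp1 : p ≤ 1) (u : ℤ) (d : ℕ) :
    ∀ L ≤ d - 1, cfgLaw p F {ω | ∀ l < L, ω ∈ unlinkedAt u d l} = ENNReal.ofReal (1 - p ^ 2) ^ L
  | 0, _ => by
    have := isProbabilityMeasure_cfgLaw (F := F) hp0 hp1
    simp
  | L + 1, hL => by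
    have ih := cfgLaw_iInter_unlinkedAt hp0 hp1 u d L (by omega)
    have h1 : {ω | ∀ l < L + 1, ω ∈ unlinkedAt u d l} =
        {ω | ∀ l < L, ω ∈ unlinkedAt u d l} ∩ unlinkedAt u d L := by
      ext ω
      simp only [Set.mem_ofPred_eq, Set.mem_inter_iff, Nat.forall_lt_succ_right]
    have hmeas : MeasurableSet {ω | ∀ l < L, ω ∈ unlinkedAt u d l} := by
      have : {ω | ∀ l < L, ω ∈ unlinkedAt u d l} = ⋂ l, ⋂ (_ : l < L), unlinkedAt u d l := by
        ext ω
        simp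
      rw [this]
      exact MeasurableSet.iInter fun l => MeasurableSet.iInter fun _ =>
        measurableSet_unlinkedAt u d l
    rw [h1, cfgLaw_inter hp0 hp1
      (S := {e | (e.1.1 = u ∧ e.1.2 < u + 1 + L) ∨ (u < e.1.1 ∧ e.1.1 < u + 1 + L ∧ e.1.2 = u + d)})
      (T := {edge u L, edge (u + 1 + L) (d - 2 - L)}) ?_ hmeas (measurableSet_unlinkedAt _ _ _)
      ?_ ?_, ih, cfgLaw_unlinkedAt hp0 hp1, ← pow_succ]
    · refine Set.disjoint_left.2 fun e he he' => ?_
      simp only [Set.mem_insert_iff, Set.mem_singleton_iff] at he'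
      simp only [Set.mem_ofPred_eq] at he
      rcases he' with rfl | rfl <;> simp only [edge] at he <;> omega
    · intro ω ω' h
      have key : ∀ l < L, (ω ∈ unlinkedAt u d l ↔ ω' ∈ unlinkedAt u d l) := by
        intro l hl
        simp only [unlinkedAt, Set.mem_ofPred_eq]
        rw [h (edge u l) (Or.inl ⟨rfl, by simp only [edge]; omega⟩),
          h (edge (u + 1 + l) (d - 2 - l)) (Or.inr (by simp only [edge]; omega))]
      simp only [Set.mem_ofPred_eq, eq_iff_iff]
      exact forall₂_congr key
    · intro ω ω' h
      simp only [unlinkedAt, Set.mem_ofPred_eq]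
      rw [h (edge u L) (by simp), h (edge (u + 1 + L) (d - 2 - L)) (by simp)]

lemma cfgLaw_not_linked (hp0 : 0 ≤ p) (hp1 : p ≤ 1) (u : ℤ) (d : ℕ) :
    cfgLaw p F {ω | ¬ Linked ω u d} = ENNReal.ofReal (1 - p ^ 2) ^ (d - 1) := by
  rw [← cfgLaw_iInter_unlinkedAt (F := F) hp0 hp1 u d (d - 1) le_rfl]
  congr 1
  ext ω
  simp [Linked, unlinkedAt]

/-- All the pairs of vertices of `[0, N]` at distance more than `g` are linked. -/
def AllLinked (g N : ℕ) (ω : Cfg) : Prop := ∀ u d : ℕ, g < d → u + d ≤ N → Linked ω u d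

lemma cfgLaw_not_allLinked_le (hp0 : 0 ≤ p) (hp1 : p ≤ 1) (g N : ℕ) :
    cfgLaw p F {ω | ¬ AllLinked g N ω} ≤ (N + 1 : ℕ) ^ 2 * ENNReal.ofReal (1 - p ^ 2) ^ g := by
  set I := (Finset.range (N + 1) ×ˢ Finset.range (N + 1)).filter fun x => g < x.2 with hI
  have h1 : {ω | ¬ AllLinked g N ω} ⊆ ⋃ x ∈ I, {ω : Cfg | ¬ Linked ω (x.1 : ℤ) x.2} := by
    intro ω hω
    simp only [AllLinked, Set.mem_ofPred_eq, not_forall] at hω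
    obtain ⟨u, d, h2, h3, h4⟩ := hω
    simp only [Set.mem_iUnion]
    refine ⟨(u, d), ?_, h4⟩
    simp only [hI, Finset.mem_filter, Finset.mem_product, Finset.mem_range]
    omega
  have hle : ENNReal.ofReal (1 - p ^ 2) ≤ 1 :=
    ENNReal.ofReal_le_one.2 (by nlinarith)
  calc cfgLaw p F {ω | ¬ AllLinked g N ω}
      ≤ ∑ x ∈ I, cfgLaw p F {ω : Cfg | ¬ Linked ω (x.1 : ℤ) x.2} :=
        (measure_mono h1).trans (measure_biUnion_finset_le _ _)
    _ ≤ ∑ x ∈ I, ENNReal.ofReal (1 - p ^ 2) ^ g := by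
        refine Finset.sum_le_sum fun x hx => ?_
        rw [cfgLaw_not_linked hp0 hp1]
        have := (Finset.mem_filter.1 hx).2
        exact pow_le_pow_right_of_le_one' hle (by omega)
    _ ≤ _ := by
        rw [Finset.sum_const, nsmul_eq_mul]
        gcongr
        have h2 : I.card ≤ (N + 1) ^ 2 := by
          refine (Finset.card_filter_le _ _).trans ?_
          simp [sq]
        exact_mod_cast h2

end Links

/-! ### The lower bound -/

/-- The interval `[b (g + 1 + ℓ) + g + 1, (b + 1) (g + 1 + ℓ))` of length `ℓ`: these intervals
are separated by gaps of length `g + 1`. -/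
noncomputable def gapWt (g ℓ b : ℕ) (ω : Cfg) : ℝ≥0∞ :=
  maxWt (b * (g + 1 + ℓ) + (g + 1) : ℕ) ((b * (g + 1 + ℓ) + (g + 1) : ℕ) + ℓ) ω

open Classical in
/-- The number of those among the first `k` intervals in which no path is heavier than `x`. -/
noncomputable def numLight (g ℓ : ℕ) (x : ℝ≥0∞) (k : ℕ) (ω : Cfg) : ℕ :=
  ((Finset.range k).filter fun b => gapWt g ℓ b ω ≤ x).card

lemma numLight_succ_of_le {g ℓ k : ℕ} {x : ℝ≥0∞} {ω : Cfg} (h : gapWt g ℓ k ω ≤ x) :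
    numLight g ℓ x (k + 1) ω = numLight g ℓ x k ω + 1 := by
  classical
  simp only [numLight, Finset.range_add_one]
  rw [Finset.filter_insert, if_pos h, Finset.card_insert_of_notMem (by simp)]

lemma numLight_succ_of_lt {g ℓ k : ℕ} {x : ℝ≥0∞} {ω : Cfg} (h : x < gapWt g ℓ k ω) :
    numLight g ℓ x (k + 1) ω = numLight g ℓ x k ω := by
  classical
  simp only [numLight, Finset.range_add_one]
  rw [Finset.filter_insert, if_neg h.not_ge]

lemma numLight_le (g ℓ : ℕ) (x : ℝ≥0∞) (k : ℕ) (ω : Cfg) : numLight g ℓ x k ω ≤ k := by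
  classical
  exact (Finset.card_filter_le _ _).trans (Finset.card_range k).le

/-- Heavy paths in different intervals are joined through the gaps; the light intervals are
skipped. -/
lemma exists_isPath_of_allLinked_aux {g ℓ N : ℕ} {x : ℝ≥0∞} {ω : Cfg} (h : AllLinked g N ω) :
    ∀ k : ℕ, k * (g + 1 + ℓ) ≤ N → ∃ (j : ℕ) (π : List Edge), j ≤ k * (g + 1 + ℓ) ∧
      IsPath (openEdges ω) 0 j π ∧ (k - numLight g ℓ x k ω : ℕ) * x ≤ pathWt ω π
  | 0, _ => ⟨0, [], by simp, rfl, by simp⟩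
  | k + 1, hk => by
    have hs : (k + 1) * (g + 1 + ℓ) = k * (g + 1 + ℓ) + (g + 1) + ℓ := by ring
    obtain ⟨j, π, hj, hπ, hw⟩ := exists_isPath_of_allLinked_aux (ℓ := ℓ) (x := x) h k (by omega)
    rcases le_or_gt (gapWt g ℓ k ω) x with hle | hlt
    · refine ⟨j, π, by omega, hπ, ?_⟩
      rw [numLight_succ_of_le hle, Nat.add_sub_add_right]
      exact hw
    · rw [numLight_succ_of_lt hlt, Nat.sub_add_comm (numLight_le _ _ _ _ _)]
      have hlt' := hlt
      unfold gapWt maxWt at hlt'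
      obtain ⟨i, hi⟩ := lt_iSup_iff.1 hlt'
      unfold maxFrom at hi
      obtain ⟨⟨i', ρ⟩, hiρ⟩ := lt_iSup_iff.1 hi
      obtain ⟨hρ, hxρ⟩ := lt_iSup_iff.1 hiρ
      simp only at hρ hxρ
      have hne : ρ ≠ [] := by
        rintro rfl
        simp at hxρ
      obtain ⟨h1, h2⟩ := hρ.endpoints hne
      have h3 := hρ.le
      obtain ⟨d, hd⟩ := Int.eq_ofNat_of_zero_le (show 0 ≤ i - j by omega)
      obtain ⟨n', hn'⟩ := Int.eq_ofNat_of_zero_le (show 0 ≤ i' by omega)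
      obtain ⟨σ, hσ⟩ := (h j d (by omega) (by omega)).exists_isPath
      have hi_eq : (j + d : ℤ) = i := by omega
      rw [hi_eq] at hσ
      subst hn'
      refine ⟨n', π ++ (σ ++ ρ), by omega,
        hπ.append (hσ.append (hρ.mono Set.inter_subset_left)), ?_⟩
      rw [pathWt_append, pathWt_append, Nat.cast_add, Nat.cast_one, add_mul, one_mul]
      exact add_le_add hw (hxρ.le.trans le_add_self)

lemma exists_isPath_of_allLinked {g ℓ N k n : ℕ} {x : ℝ≥0∞} {ω : Cfg} (h : AllLinked g N ω)
    (hn : k * (g + 1 + ℓ) + (g + 1) ≤ n) (hN : n ≤ N) :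
    ∃ π, IsPath (openEdges ω) 0 n π ∧ (k - numLight g ℓ x k ω : ℕ) * x ≤ pathWt ω π := by
  obtain ⟨j, π, hj, hπ, hw⟩ := exists_isPath_of_allLinked_aux (ℓ := ℓ) (x := x) h k (by omega)
  obtain ⟨σ, hσ⟩ := (h j (n - j) (by omega) (by omega)).exists_isPath
  have hj' : (j + (n - j : ℕ) : ℤ) = n := by omega
  rw [hj'] at hσ
  refine ⟨π ++ σ, hπ.append hσ, hw.trans ?_⟩
  rw [pathWt_append]
  exact le_self_add

section Lower

variable {p : ℝ} {F : Measure ℝ} [IsProbabilityMeasure F]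

lemma measurable_gapWt (g ℓ b : ℕ) : Measurable (gapWt g ℓ b) := measurable_maxWt _ _

lemma dependsOn_gapWt (g ℓ b : ℕ) : DependsOn (gapWt g ℓ b)
    (startIn (b * (g + 1 + ℓ) : ℕ) ((b + 1) * (g + 1 + ℓ) : ℕ)) := by
  refine (dependsOn_maxWt _ _).mono fun e he => ?_
  have h1 := he.1
  have h2 := he.2
  have h3 := e.2
  have hs : (b + 1) * (g + 1 + ℓ) = b * (g + 1 + ℓ) + (g + 1) + ℓ := by ring
  simp only [startIn, Set.mem_ofPred_eq]
  constructor <;> omega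

lemma cfgLaw_gapWt_le (hp0 : 0 ≤ p) (hp1 : p ≤ 1) (g ℓ b : ℕ) (x : ℝ≥0∞) :
    cfgLaw p F {ω | gapWt g ℓ b ω ≤ x} = cfgLaw p F {ω | maxWt 0 ℓ ω ≤ x} := by
  set a : ℤ := ((b * (g + 1 + ℓ) + (g + 1) : ℕ) : ℤ) with ha
  have h : MeasurePreserving (shift a) (cfgLaw p F) (cfgLaw p F) :=
    measurePreserving_relabel (strictMono_add_int a) hp0 hp1
  rw [← h.measure_preimage (measurableSet_le (measurable_maxWt 0 ℓ)
    measurable_const).nullMeasurableSet]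
  congr 1
  ext ω
  simp only [Set.mem_ofPred_eq, Set.mem_preimage, maxWt_shift, gapWt, ← ha, zero_add]
  rw [add_comm (ℓ : ℤ) a]

open Classical in
/-- The factor by which a light interval contributes to the exponential moment of their number. -/
noncomputable def lightFactor (g ℓ : ℕ) (x t : ℝ≥0∞) (b : ℕ) (ω : Cfg) : ℝ≥0∞ :=
  if gapWt g ℓ b ω ≤ x then t else 1

lemma measurable_lightFactor (g ℓ : ℕ) (x t : ℝ≥0∞) (b : ℕ) :
    Measurable (lightFactor g ℓ x t b) := by
  classical
  exact Measurable.ite (measurableSet_le (measurable_gapWt g ℓ b) measurable_const)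
    measurable_const measurable_const

lemma prod_lightFactor (g ℓ : ℕ) (x t : ℝ≥0∞) (ω : Cfg) : ∀ k : ℕ,
    ∏ b ∈ Finset.range k, lightFactor g ℓ x t b ω = t ^ numLight g ℓ x k ω
  | 0 => by simp [numLight]
  | k + 1 => by
    rw [Finset.prod_range_succ, prod_lightFactor g ℓ x t ω k]
    rcases le_or_gt (gapWt g ℓ k ω) x with h | h
    · rw [numLight_succ_of_le h, pow_succ, lightFactor, if_pos h]
    · rw [numLight_succ_of_lt h, lightFactor, if_neg h.not_ge, mul_one]

lemma lintegral_lightFactor_le (hp0 : 0 ≤ p) (hp1 : p ≤ 1) (g ℓ : ℕ) (x t : ℝ≥0∞) (b : ℕ) :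
    ∫⁻ ω, lightFactor g ℓ x t b ω ∂cfgLaw p F ≤
      1 + t * cfgLaw p F {ω | maxWt 0 ℓ ω ≤ x} := by
  classical
  have := isProbabilityMeasure_cfgLaw (F := F) hp0 hp1
  have hS : MeasurableSet {ω | gapWt g ℓ b ω ≤ x} :=
    measurableSet_le (measurable_gapWt g ℓ b) measurable_const
  calc ∫⁻ ω, lightFactor g ℓ x t b ω ∂cfgLaw p F
      ≤ ∫⁻ ω, (1 + {ω | gapWt g ℓ b ω ≤ x}.indicator (fun _ => t) ω) ∂cfgLaw p F := by
        refine lintegral_mono fun ω => ?_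
        unfold lightFactor
        by_cases h : gapWt g ℓ b ω ≤ x <;> simp [h]
    _ = _ := by
        rw [lintegral_add_left measurable_const, lintegral_indicator_const hS,
          cfgLaw_gapWt_le hp0 hp1]
        simp

lemma lintegral_prod_lightFactor_le (hp0 : 0 ≤ p) (hp1 : p ≤ 1) (g ℓ : ℕ) (x t : ℝ≥0∞) :
    ∀ k : ℕ, ∫⁻ ω, ∏ b ∈ Finset.range k, lightFactor g ℓ x t b ω ∂cfgLaw p F ≤
      (1 + t * cfgLaw p F {ω | maxWt 0 ℓ ω ≤ x}) ^ k
  | 0 => by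
    have := isProbabilityMeasure_cfgLaw (F := F) hp0 hp1
    simp
  | k + 1 => by
    have ih := lintegral_prod_lightFactor_le hp0 hp1 g ℓ x t k
    have hm1 : Measurable fun ω => ∏ b ∈ Finset.range k, lightFactor g ℓ x t b ω :=
      Finset.measurable_fun_prod _ fun b _ => measurable_lightFactor g ℓ x t b
    have hm2 := measurable_lightFactor g ℓ x t k
    have hd : ∀ b, DependsOn (lightFactor g ℓ x t b)
        (startIn (b * (g + 1 + ℓ) : ℕ) ((b + 1) * (g + 1 + ℓ) : ℕ)) := fun b ω ω' h => by
      rw [lightFactor, lightFactor, dependsOn_gapWt g ℓ b h]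
    have hind : IndepFun (fun ω => ∏ b ∈ Finset.range k, lightFactor g ℓ x t b ω)
        (lightFactor g ℓ x t k) (cfgLaw p F) := by
      refine cfgLaw_indepFun hp0 hp1 (S := {e | e.1.1 < (k * (g + 1 + ℓ) : ℕ)}) ?_ hm1 hm2 ?_ (hd k)
      · refine Set.disjoint_left.2 fun e he he' => ?_
        exact absurd he'.1 (not_le.2 he)
      · intro ω ω' h
        refine Finset.prod_congr rfl fun b hb => hd b fun e he => h e ?_
        have h1 : (b + 1) * (g + 1 + ℓ) ≤ k * (g + 1 + ℓ) :=
          Nat.mul_le_mul_right _ (Finset.mem_range.1 hb)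
        exact he.2.trans_le (by exact_mod_cast h1)
    simp only [Finset.prod_range_succ, pow_succ]
    refine (lintegral_mul_eq_lintegral_mul_lintegral_of_indepFun hm1 hm2 hind).trans_le ?_
    exact mul_le_mul' ih (lintegral_lightFactor_le hp0 hp1 g ℓ x t k)

/-- If every interval is light with a small probability, then with a probability exponentially close
to one only a small fraction of them is light. -/
lemma cfgLaw_numLight_le (hp0 : 0 ≤ p) (hp1 : p ≤ 1) (g ℓ : ℕ) (x : ℝ≥0∞) {M : ℕ}
    (hx : 4 ^ M * cfgLaw p F {ω | maxWt 0 ℓ ω ≤ x} ≤ 1) (k : ℕ) :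
    cfgLaw p F {ω | k ≤ M * numLight g ℓ x k ω} ≤ 2⁻¹ ^ k := by
  -- Exponential Markov inequality: the mean of `4 ^ (M * numLight)` is at most `2 ^ k`.
  have h1 : {ω | k ≤ M * numLight g ℓ x k ω} ⊆
      {ω | 4 ^ k ≤ ∏ b ∈ Finset.range k, lightFactor g ℓ x (4 ^ M) b ω} := by
    intro ω hω
    simp only [Set.mem_ofPred_eq, prod_lightFactor, ← pow_mul] at hω ⊢
    exact pow_le_pow_right₀ (by norm_num) hω
  have h4 : (4 : ℝ≥0∞) ^ k ≠ 0 := by positivity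
  have h4' : (4 : ℝ≥0∞) ^ k ≠ ∞ := by finiteness
  have h2 := meas_ge_le_lintegral_div (μ := cfgLaw p F)
    (f := fun ω => ∏ b ∈ Finset.range k, lightFactor g ℓ x (4 ^ M) b ω)
    (Finset.measurable_fun_prod _ fun b _ => measurable_lightFactor g ℓ x _ b).aemeasurable h4 h4'
  refine (measure_mono h1).trans (h2.trans ?_)
  refine ENNReal.div_le_of_le_mul ?_
  refine (lintegral_prod_lightFactor_le hp0 hp1 g ℓ x (4 ^ M) k).trans ?_
  rw [← mul_pow]
  refine pow_le_pow_left' ?_ k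
  have h5 : (2 : ℝ≥0∞)⁻¹ * 4 = 2 := by
    rw [show (4 : ℝ≥0∞) = 2 * 2 by norm_num, ← mul_assoc,
      ENNReal.inv_mul_cancel two_ne_zero ENNReal.ofNat_ne_top, one_mul]
  rw [h5]
  calc 1 + 4 ^ M * cfgLaw p F {ω | maxWt 0 ℓ ω ≤ x} ≤ 1 + 1 := by gcongr
    _ = 2 := one_add_one_eq_two

end Lower

/-! ### The almost sure lower bound -/

/-- The smallest length that accommodates `g ^ 2` intervals of length `g ^ 2` separated by gaps
of length `g + 1`. -/
def scale (g : ℕ) : ℕ := g ^ 2 * (g + 1 + g ^ 2) + (g + 1)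

lemma scale_succ_le (g : ℕ) : scale (g + 1) + 1 ≤ (g + 2) ^ 4 := by
  have h : (g + 2) ^ 4 = scale (g + 1) + 1 + (3 * g ^ 3 + 14 * g ^ 2 + 22 * g + 10) := by
    unfold scale
    ring
  omega

lemma eventually_exists_scale {q : ℕ → Prop} (h : ∀ᶠ g in atTop, q g) :
    ∀ᶠ n in atTop, ∃ g, q g ∧ scale g ≤ n ∧ n < scale (g + 1) := by
  obtain ⟨G, hG⟩ := eventually_atTop.1 h
  have hlt : ∀ g, g < scale g := fun g => by
    unfold scale
    omega
  filter_upwards [eventually_ge_atTop (scale G)] with n hn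
  have hGn : G ≤ n := (hlt G).le.trans hn
  refine ⟨Nat.findGreatest (fun g => scale g ≤ n) n, hG _ (Nat.le_findGreatest hGn hn),
    Nat.findGreatest_spec (P := fun g => scale g ≤ n) hGn hn, ?_⟩
  by_contra! hcon
  have h1 := hlt (Nat.findGreatest (fun g => scale g ≤ n) n + 1)
  have h2 := Nat.le_findGreatest (P := fun g => scale g ≤ n) (h1.le.trans hcon) hcon
  omega

/-- A form of the Borel–Cantelli lemma for events with summable bounds on their tails. -/
lemma ae_eventually_not_of_le {Ω : Type*} [MeasurableSpace Ω] {P : Measure Ω} {s : ℕ → Ω → Prop}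
    {u : ℕ → ℝ≥0∞} (hu : ∑' g, u g ≠ ∞) (h : ∀ᶠ g in atTop, P {ω | s g ω} ≤ u g) :
    ∀ᵐ ω ∂P, ∀ᶠ g in atTop, ¬ s g ω := by
  obtain ⟨G, hG⟩ := eventually_atTop.1 h
  have h1 : ∑' g, P {ω | s (g + G) ω} ≠ ∞ := by
    refine ne_top_of_le_ne_top hu ?_
    exact (ENNReal.tsum_le_tsum fun g => hG (g + G) (by omega)).trans
      (ENNReal.tsum_comp_le_tsum_of_injective (add_left_injective G) u)
  filter_upwards [ae_eventually_notMem h1] with ω hω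
  rw [← map_add_atTop_eq_nat G]
  exact hω

section LowerAE

variable {p : ℝ} {F : Measure ℝ} [IsProbabilityMeasure F]

lemma ae_eventually_allLinked (hp0 : 0 < p) (hp1 : p ≤ 1) :
    ∀ᵐ ω ∂cfgLaw p F, ∀ᶠ g in atTop, AllLinked g (scale (g + 1)) ω := by
  -- `r` is positive, unlike `1 - p ^ 2`, so that powers of `r` can be shifted.
  set r : ℝ := 1 - p ^ 2 / 2 with hr
  have hr0 : 0 < r := by nlinarith
  have hr1 : r < 1 := by nlinarith
  have hsum : Summable fun g : ℕ => ((g + 2 : ℕ) : ℝ) ^ 8 * r ^ g := by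
    have h1 : Summable fun n : ℕ => (n : ℝ) ^ 8 * r ^ n :=
      summable_pow_mul_geometric_of_norm_lt_one 8 (by rwa [Real.norm_of_nonneg hr0.le])
    refine (((summable_nat_add_iff 2).2 h1).mul_right (r ^ 2)⁻¹).congr fun g => ?_
    rw [pow_add r, ← mul_assoc, mul_assoc, mul_inv_cancel₀ (by positivity), mul_one]
  have key := ae_eventually_not_of_le (P := cfgLaw p F) (s := fun g ω =>
    ¬ AllLinked g (scale (g + 1)) ω) hsum.tsum_ofReal_ne_top (Eventually.of_forall fun g => by
      refine (cfgLaw_not_allLinked_le hp0.le hp1 g _).trans ?_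
      rw [ENNReal.ofReal_mul (by positivity), ENNReal.ofReal_pow (Nat.cast_nonneg _),
        ENNReal.ofReal_pow hr0.le, ENNReal.ofReal_natCast]
      gcongr ?_ * ?_ ^ g
      · have h2 := Nat.pow_le_pow_left (scale_succ_le g) 2
        rw [← pow_mul] at h2
        exact_mod_cast h2
      · exact ENNReal.ofReal_le_ofReal (by nlinarith))
  filter_upwards [key] with ω hω
  simpa using hω

lemma ae_eventually_numLight_lt (hp0 : 0 ≤ p) (hp1 : p ≤ 1)
    (hF2 : Integrable (fun x : ℝ => x ^ 2) F) {C : ℝ}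
    (hC : Tendsto (fun n : ℕ => meanWt p F n / n) atTop (𝓝 C)) {x : ℝ} (hx0 : 0 ≤ x) (hx : x < C)
    (M : ℕ) : ∀ᵐ ω ∂cfgLaw p F, ∀ᶠ g : ℕ in atTop,
      M * numLight g (g ^ 2) (ENNReal.ofReal (x * (g ^ 2 : ℕ))) (g ^ 2) ω < g ^ 2 := by
  have h1 := (tendsto_measure_maxWt_le (p := p) hp0 hp1 hF2 hC hx0 hx).comp
    (tendsto_pow_atTop (α := ℕ) two_ne_zero)
  have h4 : (4 : ℝ≥0∞) ^ M ≠ ∞ := by finiteness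
  have h4' : (4 : ℝ≥0∞) ^ M ≠ 0 := by positivity
  have h2 := h1.eventually_lt_const (ENNReal.inv_pos.2 h4)
  have hsum : ∑' g : ℕ, (2 : ℝ≥0∞)⁻¹ ^ g ≠ ∞ := by
    rw [ENNReal.tsum_geometric]
    simp
  have key := ae_eventually_not_of_le (P := cfgLaw p F) (s := fun g ω =>
    g ^ 2 ≤ M * numLight g (g ^ 2) (ENNReal.ofReal (x * (g ^ 2 : ℕ))) (g ^ 2) ω) hsum (by
      filter_upwards [h2] with g hg
      refine (cfgLaw_numLight_le hp0 hp1 g (g ^ 2) _ (M := M) ?_ (g ^ 2)).trans ?_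
      · rw [mul_comm]
        exact (ENNReal.le_inv_iff_mul_le).1 hg.le
      · exact pow_le_pow_right_of_le_one' (by simp) (Nat.le_self_pow two_ne_zero g))
  filter_upwards [key] with ω hω
  simpa using hω

/-- Almost surely, the lower growth rate is at least the growth rate of the mean. -/
lemma ae_eventually_exists_isPath (hp0 : 0 < p) (hp1 : p ≤ 1)
    (hF2 : Integrable (fun x : ℝ => x ^ 2) F) {C : ℝ}
    (hC : Tendsto (fun n : ℕ => meanWt p F n / n) atTop (𝓝 C)) {y : ℝ} (hy0 : 0 ≤ y) (hy : y < C) :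
    ∀ᵐ ω ∂cfgLaw p F, ∀ᶠ n : ℕ in atTop, ∃ π, IsPath (openEdges ω) 0 n π ∧
      ENNReal.ofReal (y * n) ≤ pathWt ω π := by
  obtain ⟨x, hyx, hxC⟩ := exists_between hy
  have hx0 : 0 < x := hy0.trans_lt hyx
  obtain ⟨M, hM⟩ := exists_nat_gt (x / (x - y))
  have hM0 : (0 : ℝ) < M := (div_pos hx0 (sub_pos.2 hyx)).trans hM
  -- At most a fraction `1 / M` of the intervals will be light.
  have hM1 : y < x * (1 - 1 / M) := by
    rw [div_lt_iff₀ (sub_pos.2 hyx)] at hM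
    have : x / M < x - y := by
      rw [div_lt_iff₀ hM0]
      linarith
    calc y < x - x / M := by linarith
      _ = x * (1 - 1 / M) := by ring
  have hscale : ∀ᶠ g : ℕ in atTop, y * ((g + 2 : ℕ) : ℝ) ^ 4 < x * (1 - 1 / M) * (g : ℝ) ^ 4 := by
    have h1 : Tendsto (fun g : ℕ => x * (1 - 1 / M) * ((g : ℝ) / (g + 2)) ^ 4) atTop
        (𝓝 (x * (1 - 1 / M))) := by
      simpa using ((tendsto_natCast_div_add_atTop (2 : ℝ)).pow 4).const_mul (x * (1 - 1 / M))
    filter_upwards [h1.eventually_const_lt hM1] with g hg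
    rw [div_pow, mul_div_assoc', lt_div_iff₀ (by positivity)] at hg
    exact_mod_cast hg
  filter_upwards [ae_eventually_allLinked (F := F) hp0 hp1,
    ae_eventually_numLight_lt hp0.le hp1 hF2 hC hx0.le hxC M] with ω h1 h2
  filter_upwards [eventually_exists_scale (h1.and (h2.and hscale))] with n ⟨g, ⟨h3, h4, h5⟩, h6, h7⟩
  obtain ⟨π, hπ, hw⟩ := exists_isPath_of_allLinked (ℓ := g ^ 2) (k := g ^ 2)
    (x := ENNReal.ofReal (x * (g ^ 2 : ℕ))) h3 h6 h7.le
  refine ⟨π, hπ, le_trans ?_ hw⟩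
  set L := numLight g (g ^ 2) (ENNReal.ofReal (x * (g ^ 2 : ℕ))) (g ^ 2) ω
  have hL : L ≤ g ^ 2 := numLight_le _ _ _ _ _
  rw [← ENNReal.ofReal_natCast, ← ENNReal.ofReal_mul (Nat.cast_nonneg _)]
  refine ENNReal.ofReal_le_ofReal ?_
  have h8 : (n : ℝ) ≤ ((g + 2 : ℕ) : ℝ) ^ 4 := by
    have := scale_succ_le g
    exact_mod_cast (by omega : n ≤ (g + 2) ^ 4)
  have h9 : (1 - 1 / M) * (g : ℝ) ^ 2 ≤ ((g ^ 2 - L : ℕ) : ℝ) := by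
    rw [Nat.cast_sub hL]
    have h10 : (M : ℝ) * L < (g : ℝ) ^ 2 := by exact_mod_cast h4
    have h11 : (L : ℝ) ≤ (g : ℝ) ^ 2 / M := by
      rw [le_div_iff₀ hM0]
      linarith
    push_cast
    calc (1 - 1 / M) * (g : ℝ) ^ 2 = (g : ℝ) ^ 2 - (g : ℝ) ^ 2 / M := by ring
      _ ≤ _ := by linarith
  calc y * n ≤ y * ((g + 2 : ℕ) : ℝ) ^ 4 := by gcongr
    _ ≤ x * (1 - 1 / M) * (g : ℝ) ^ 4 := h5.le
    _ = (1 - 1 / M) * (g : ℝ) ^ 2 * (x * (g ^ 2 : ℕ)) := by push_cast; ring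
    _ ≤ _ := by gcongr

end LowerAE

/-! ### The passage time -/

/-- The passage time from `0` to `n` in the configuration `ω`. -/
noncomputable def passage (n : ℕ) (ω : Cfg) : EReal :=
  passageTime (openEdges ω) (fun e => (ω e).2) 0 n

/-- The positive part of the passage time from `0` to `n` in the configuration `ω`. -/
noncomputable def passagePos (n : ℕ) (ω : Cfg) : ℝ := (max (passage n ω) 0).toReal

lemma measurable_pathWeight (π : List Edge) :
    Measurable fun ω : Cfg => pathWeight (fun e => (ω e).2) π := by
  induction π with
  | nil => exact measurable_const
  | cons e π ih =>
    simp only [pathWeight, List.map_cons, List.sum_cons] at ih ⊢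
    exact (measurable_snd.comp (measurable_pi_apply e)).add ih

lemma measurable_passage (n : ℕ) : Measurable (passage n) := by
  classical
  unfold passage passageTime
  refine Measurable.iSup fun π => ?_
  have h : (fun ω : Cfg => ⨆ (_ : IsPath (openEdges ω) 0 n π),
      (pathWeight (fun e => (ω e).2) π : EReal)) =
      fun ω => if IsPath (openEdges ω ∩ Set.univ) 0 n π then
        (pathWeight (fun e => (ω e).2) π : EReal) else ⊥ := by
    funext ω
    rw [Set.inter_univ]
    split_ifs with h <;> simp [h]
  rw [h]
  exact Measurable.ite (measurableSet_isPath _ _ _ _)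
    (measurable_coe_real_ereal.comp (measurable_pathWeight π)) measurable_const

lemma measurable_passagePos (n : ℕ) : Measurable (passagePos n) :=
  measurable_ereal_toReal.comp ((measurable_passage n).max measurable_const)

lemma passagePos_nonneg (n : ℕ) (ω : Cfg) : 0 ≤ passagePos n ω :=
  EReal.toReal_nonneg (le_max_right _ _)

lemma pathWeight_nonneg {ω : Cfg} (hω : ∀ e, 0 < (ω e).2) (π : List Edge) :
    0 ≤ pathWeight (fun e => (ω e).2) π :=
  List.sum_nonneg fun x hx => by
    obtain ⟨e, -, rfl⟩ := List.mem_map.1 hx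
    exact (hω e).le

lemma pathWt_eq_ofReal {ω : Cfg} (hω : ∀ e, 0 < (ω e).2) (π : List Edge) :
    pathWt ω π = ENNReal.ofReal (pathWeight (fun e => (ω e).2) π) := by
  induction π with
  | nil => simp [pathWeight]
  | cons e π ih =>
    rw [pathWt_cons, ih, wt, ← ENNReal.ofReal_add (hω e).le (pathWeight_nonneg hω π)]
    rfl

lemma passage_le {ω : Cfg} (hω : ∀ e, 0 < (ω e).2) {n : ℕ} (hn : maxWt 0 (n + 1 : ℕ) ω < ∞) :
    passage n ω ≤ ((maxWt 0 (n + 1 : ℕ) ω).toReal : EReal) := by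
  refine iSup₂_le fun π hπ => EReal.coe_le_coe_iff.2 ?_
  refine (ENNReal.ofReal_le_iff_le_toReal hn.ne).1 ?_
  rw [← pathWt_eq_ofReal hω]
  exact pathWt_le_maxWt (hπ.restrict le_rfl (by push_cast; omega))

lemma passagePos_le {ω : Cfg} (hω : ∀ e, 0 < (ω e).2) {n : ℕ}
    (hn : maxWt 0 (n + 1 : ℕ) ω < ∞) : passagePos n ω ≤ (maxWt 0 (n + 1 : ℕ) ω).toReal := by
  have h : max (passage n ω) 0 ≤ ((maxWt 0 (n + 1 : ℕ) ω).toReal : EReal) :=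
    max_le (passage_le hω hn) (EReal.coe_nonneg.2 ENNReal.toReal_nonneg)
  have h1 := EReal.toReal_le_toReal h (ne_bot_of_le_ne_bot EReal.zero_ne_bot (le_max_right _ _))
    (EReal.coe_ne_top _)
  rwa [EReal.toReal_coe] at h1

lemma le_passage {ω : Cfg} {n : ℕ} {π : List Edge} (hπ : IsPath (openEdges ω) 0 n π) :
    (pathWeight (fun e => (ω e).2) π : EReal) ≤ passage n ω :=
  le_iSup₂ (f := fun (π : List Edge) (_ : IsPath (openEdges ω) 0 n π) =>
    (pathWeight (fun e => (ω e).2) π : EReal)) π hπ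

/-- If there is a path from `0` to `n`, then the passage time is a nonnegative real number. -/
lemma passage_eq_coe {ω : Cfg} (hω : ∀ e, 0 < (ω e).2) {n : ℕ} (hn : maxWt 0 (n + 1 : ℕ) ω < ∞)
    {π : List Edge} (hπ : IsPath (openEdges ω) 0 n π) : passage n ω = (passagePos n ω : EReal) := by
  have h0 : 0 ≤ passage n ω :=
    (EReal.coe_nonneg.2 (pathWeight_nonneg hω π)).trans (le_passage hπ)
  rw [passagePos, max_eq_left h0, EReal.coe_toReal]
  · exact ne_top_of_le_ne_top (EReal.coe_ne_top _) (passage_le hω hn)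
  · exact ne_bot_of_le_ne_bot EReal.zero_ne_bot h0

lemma le_passagePos {ω : Cfg} (hω : ∀ e, 0 < (ω e).2) {n : ℕ} (hn : maxWt 0 (n + 1 : ℕ) ω < ∞)
    {π : List Edge} (hπ : IsPath (openEdges ω) 0 n π) {x : ℝ}
    (hx : ENNReal.ofReal x ≤ pathWt ω π) : x ≤ passagePos n ω := by
  rw [pathWt_eq_ofReal hω] at hx
  have h1 := (ENNReal.ofReal_le_ofReal_iff (pathWeight_nonneg hω π)).1 hx
  have h2 := le_passage hπ
  rw [passage_eq_coe hω hn hπ, EReal.coe_le_coe_iff] at h2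
  exact h1.trans h2

/-! ### The limit of the passage time -/

section Limit

variable {p : ℝ} {F : Measure ℝ} [IsProbabilityMeasure F]

lemma ae_tendsto_passagePos (hp0 : 0 < p) (hp1 : p ≤ 1) (hFpos : ∀ᵐ x ∂F, 0 < x)
    (hF2 : Integrable (fun x : ℝ => x ^ 2) F) {C : ℝ} (hC0 : 0 < C)
    (hC : Tendsto (fun n : ℕ => meanWt p F n / n) atTop (𝓝 C)) :
    ∀ᵐ ω ∂cfgLaw p F, Tendsto (fun n : ℕ => passagePos n ω / n) atTop (𝓝 C) ∧
      ∀ᶠ n : ℕ in atTop, passage n ω = (passagePos n ω : EReal) := by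
  have hup : ∀ᵐ ω ∂cfgLaw p F, ∀ j : ℕ, ∀ᶠ n : ℕ in atTop,
      (maxWt 0 n ω).toReal / n < C + 1 / ((j : ℝ) + 1) :=
    ae_all_iff.2 fun j => ae_eventually_maxWt_div_lt hp0.le hp1 hF2 hC (by positivity)
  have hlow : ∀ᵐ ω ∂cfgLaw p F, ∀ j : ℕ, ∀ᶠ n : ℕ in atTop, ∃ π, IsPath (openEdges ω) 0 n π ∧
      ENNReal.ofReal (max 0 (C - 1 / ((j : ℝ) + 1)) * n) ≤ pathWt ω π :=
    ae_all_iff.2 fun j => ae_eventually_exists_isPath hp0 hp1 hF2 hC (le_max_left _ _)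
      (max_lt hC0 (sub_lt_self _ (by positivity)))
  filter_upwards [ae_weight_pos hp0.le hp1 hFpos, ae_maxWt_lt_top hp0.le hp1 hF2, hup, hlow]
    with ω hpos hfin h1 h2
  refine ⟨tendsto_order.2 ⟨fun a ha => ?_, fun a ha => ?_⟩, ?_⟩
  · obtain ⟨j, hj⟩ := exists_nat_one_div_lt (sub_pos.2 ha)
    filter_upwards [h2 j, eventually_gt_atTop 0] with n ⟨π, hπ, hw⟩ hn
    have h3 := le_passagePos hpos (hfin (n + 1)) hπ hw
    have hn' : (0 : ℝ) < n := by exact_mod_cast hn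
    rw [lt_div_iff₀ hn']
    refine lt_of_lt_of_le ?_ h3
    gcongr
    exact lt_max_of_lt_right (by linarith)
  · obtain ⟨j, hj⟩ := exists_nat_one_div_lt (sub_pos.2 ha)
    have h3 : Tendsto (fun n : ℕ => (C + 1 / ((j : ℝ) + 1)) * (1 + 1 / (n : ℝ))) atTop
        (𝓝 (C + 1 / ((j : ℝ) + 1))) := by
      simpa using (tendsto_one_div_atTop_nhds_zero_nat (𝕜 := ℝ)).const_add 1 |>.const_mul
        (C + 1 / ((j : ℝ) + 1))
    filter_upwards [(tendsto_add_atTop_nat 1).eventually (h1 j), eventually_gt_atTop 0,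
      h3.eventually_lt_const (show C + 1 / ((j : ℝ) + 1) < a by linarith)] with n h4 hn h5
    have hn' : (0 : ℝ) < n := by exact_mod_cast hn
    rw [div_lt_iff₀ (by positivity)] at h4
    refine lt_of_le_of_lt ?_ h5
    rw [div_le_iff₀ hn']
    refine (passagePos_le hpos (hfin (n + 1))).trans (h4.le.trans_eq ?_)
    push_cast
    field_simp
  · filter_upwards [h2 0] with n ⟨π, hπ, _⟩
    exact passage_eq_coe hpos (hfin (n + 1)) hπ

lemma integrable_passagePos (hp0 : 0 ≤ p) (hp1 : p ≤ 1) (hFpos : ∀ᵐ x ∂F, 0 < x)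
    (hF2 : Integrable (fun x : ℝ => x ^ 2) F) (n : ℕ) :
    Integrable (passagePos n) (cfgLaw p F) := by
  refine (integrable_maxWt hp0 hp1 hF2 (n + 1)).mono' (measurable_passagePos n).aestronglyMeasurable
    ?_
  filter_upwards [ae_weight_pos hp0 hp1 hFpos, ae_maxWt_lt_top hp0 hp1 hF2] with ω hpos hfin
  rw [Real.norm_of_nonneg (passagePos_nonneg n ω)]
  exact passagePos_le hpos (hfin (n + 1))

/-- Convergence in `L¹`: the negative part of the difference to `C` is bounded, and the positive
part is controlled by the best path in `[0, n]`. -/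
lemma tendsto_integral_abs_passagePos (hp0 : 0 < p) (hp1 : p ≤ 1) (hFpos : ∀ᵐ x ∂F, 0 < x)
    (hF2 : Integrable (fun x : ℝ => x ^ 2) F) {C : ℝ} (hC0 : 0 < C)
    (hC : Tendsto (fun n : ℕ => meanWt p F n / n) atTop (𝓝 C)) :
    Tendsto (fun n : ℕ => ∫ ω, |passagePos n ω / n - C| ∂cfgLaw p F) atTop (𝓝 0) := by
  have := isProbabilityMeasure_cfgLaw (F := F) hp0.le hp1
  have hmeas : ∀ n : ℕ, Measurable fun ω => max (C - passagePos n ω / n) 0 := fun n =>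
    (((measurable_passagePos n).div_const _).const_sub C).max measurable_const
  have hbound : ∀ (n : ℕ) (ω : Cfg), ‖max (C - passagePos n ω / n) 0‖ ≤ C := fun n ω => by
    have : 0 ≤ passagePos n ω / n := div_nonneg (passagePos_nonneg n ω) (Nat.cast_nonneg n)
    rw [Real.norm_of_nonneg (le_max_right _ _)]
    exact max_le (by linarith) hC0.le
  have h1 : Tendsto (fun n : ℕ => ∫ ω, max (C - passagePos n ω / n) 0 ∂cfgLaw p F) atTop
      (𝓝 0) := by
    have := tendsto_integral_of_dominated_convergence (μ := cfgLaw p F)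
      (F := fun (n : ℕ) ω => max (C - passagePos n ω / n) 0) (f := fun _ => 0) (fun _ => C)
      (fun n => (hmeas n).aestronglyMeasurable) (integrable_const C)
      (fun n => Eventually.of_forall (hbound n)) (by
        filter_upwards [ae_tendsto_passagePos hp0 hp1 hFpos hF2 hC0 hC] with ω hω
        simpa using (hω.1.const_sub C).max (tendsto_const_nhds (x := (0 : ℝ))))
    simpa using this
  have h2 := (tendsto_integral_abs_maxWt (p := p) hp0.le hp1 hF2 hC).comp (tendsto_add_atTop_nat 1)
  have h3 : Tendsto (fun n : ℕ => (1 : ℝ) + 1 / n) atTop (𝓝 1) := by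
    simpa using (tendsto_one_div_atTop_nhds_zero_nat (𝕜 := ℝ)).const_add 1
  have h4 := (h1.add (h3.mul h2)).add (tendsto_const_div_atTop_nhds_zero_nat C)
  simp only [mul_zero, add_zero] at h4
  refine tendsto_of_tendsto_of_tendsto_of_le_of_le' tendsto_const_nhds h4
    (Eventually.of_forall fun n => integral_nonneg fun ω => abs_nonneg _) ?_
  filter_upwards [eventually_gt_atTop 0] with n hn
  have hn' : (0 : ℝ) < n := by exact_mod_cast hn
  have hA : Integrable (fun ω => max (C - passagePos n ω / n) 0) (cfgLaw p F) :=
    (integrable_const C).mono' (hmeas n).aestronglyMeasurable (Eventually.of_forall (hbound n))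
  have hB : Integrable (fun ω => |(maxWt 0 (n + 1 : ℕ) ω).toReal / (n + 1 : ℕ) - C|)
      (cfgLaw p F) :=
    (((integrable_maxWt hp0.le hp1 hF2 (n + 1)).div_const _).sub (integrable_const _)).abs
  have hAB : Integrable (fun ω => max (C - passagePos n ω / n) 0 +
      (1 + 1 / (n : ℝ)) * |(maxWt 0 (n + 1 : ℕ) ω).toReal / (n + 1 : ℕ) - C|) (cfgLaw p F) :=
    hA.add (hB.const_mul _)
  calc ∫ ω, |passagePos n ω / n - C| ∂cfgLaw p F
      ≤ ∫ ω, (max (C - passagePos n ω / n) 0 +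
          (1 + 1 / (n : ℝ)) * |(maxWt 0 (n + 1 : ℕ) ω).toReal / (n + 1 : ℕ) - C| + C / n)
          ∂cfgLaw p F := by
        refine integral_mono_ae (((integrable_passagePos hp0.le hp1 hFpos hF2 n).div_const _).sub
          (integrable_const _)).abs (hAB.add (integrable_const _)) ?_
        filter_upwards [ae_weight_pos hp0.le hp1 hFpos, ae_maxWt_lt_top hp0.le hp1 hF2]
          with ω hpos hfin
        have h5 := passagePos_le hpos (hfin (n + 1))
        have h6 : passagePos n ω / n ≤ (maxWt 0 (n + 1 : ℕ) ω).toReal / n := by gcongr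
        have h7 : (maxWt 0 (n + 1 : ℕ) ω).toReal / n - C = (1 + 1 / (n : ℝ)) *
            ((maxWt 0 (n + 1 : ℕ) ω).toReal / (n + 1 : ℕ) - C) + C / n := by
          push_cast
          field_simp
          ring
        have h8 : (1 + 1 / (n : ℝ)) * ((maxWt 0 (n + 1 : ℕ) ω).toReal / (n + 1 : ℕ) - C) ≤
            (1 + 1 / (n : ℝ)) * |(maxWt 0 (n + 1 : ℕ) ω).toReal / (n + 1 : ℕ) - C| := by
          gcongr
          exact le_abs_self _
        have h9 : 0 ≤ (1 + 1 / (n : ℝ)) *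
            |(maxWt 0 (n + 1 : ℕ) ω).toReal / (n + 1 : ℕ) - C| := by positivity
        have h10 : 0 ≤ C / n := by positivity
        have h11 := le_max_left (C - passagePos n ω / n) 0
        have h12 := le_max_right (C - passagePos n ω / n) 0
        rw [abs_le]
        constructor <;> linarith
    _ = _ := by
        rw [integral_add hAB (integrable_const _), integral_add hA (hB.const_mul _),
          integral_const_mul]
        simp

end Limit

end LongRangeLPP

theorem theorem1 (p : ℝ) (hp0 : 0 < p) (hp1 : p ≤ 1)
    (F : Measure ℝ) [IsProbabilityMeasure F] (hFpos : ∀ᵐ x ∂F, 0 < x)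
    (hF2 : Integrable (fun x : ℝ => x ^ 2) F) :
    ∃ C : ℝ, 0 < C ∧
      ∀ (Ω : Type*) [MeasurableSpace Ω] (P : Measure Ω) [IsProbabilityMeasure P]
        (α : LongRangeLPP.Edge → Ω → Bool) (v : LongRangeLPP.Edge → Ω → ℝ),
        LongRangeLPP.IsModel P p F α v →
        (∀ᵐ ω ∂P, Tendsto (fun n : ℕ => LongRangeLPP.w α v 0 (n : ℤ) ω / (n : EReal)) atTop
          (𝓝 (C : EReal))) ∧
        (∀ n : ℕ, Integrable (LongRangeLPP.wPos α v 0 (n : ℤ)) P) ∧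
        Tendsto (fun n : ℕ => eLpNorm
          (fun ω => LongRangeLPP.wPos α v 0 (n : ℤ) ω / (n : ℝ) - C) 1 P) atTop (𝓝 0) := by
  obtain ⟨C, hC⟩ := LongRangeLPP.exists_tendsto_meanWt (F := F) hp0.le hp1 hF2
  have hC0 := LongRangeLPP.growthRate_pos hp0 hp1 hFpos hF2 hC
  refine ⟨C, hC0, fun Ω _ P _ α v hmodel => ?_⟩
  have hX := hmodel.measurePreserving hp0.le
  have hw : ∀ (n : ℕ) (ω : Ω), LongRangeLPP.w α v 0 (n : ℤ) ω =
      LongRangeLPP.passage n fun e => (α e ω, v e ω) := fun _ _ => rfl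
  have hwPos : ∀ n : ℕ, LongRangeLPP.wPos α v 0 (n : ℤ) =
      LongRangeLPP.passagePos n ∘ fun ω e => (α e ω, v e ω) := fun _ => rfl
  refine ⟨?_, fun n => ?_, ?_⟩
  · filter_upwards [hX.quasiMeasurePreserving.ae
      (LongRangeLPP.ae_tendsto_passagePos hp0 hp1 hFpos hF2 hC0 hC)] with ω ⟨h1, h2⟩
    refine ((continuous_coe_real_ereal.tendsto C).comp h1).congr' ?_
    filter_upwards [h2] with n hn
    rw [hw, hn, Function.comp_apply, EReal.coe_div]
    rfl
  · rw [hwPos]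
    exact hX.integrable_comp_of_integrable
      (LongRangeLPP.integrable_passagePos hp0.le hp1 hFpos hF2 n)
  · have := LongRangeLPP.isProbabilityMeasure_cfgLaw (F := F) hp0.le hp1
    have h1 := ENNReal.tendsto_ofReal
      (LongRangeLPP.tendsto_integral_abs_passagePos hp0 hp1 hFpos hF2 hC0 hC)
    rw [ENNReal.ofReal_zero] at h1
    refine h1.congr fun n => ?_
    have hint : Integrable (fun ω => LongRangeLPP.passagePos n ω / n - C)
        (LongRangeLPP.cfgLaw p F) :=
      ((LongRangeLPP.integrable_passagePos hp0.le hp1 hFpos hF2 n).div_const _).sub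
        (integrable_const C)
    have h2 := eLpNorm_comp_measurePreserving (p := 1) hint.aestronglyMeasurable hX
    refine Eq.trans ?_ h2.symm
    rw [eLpNorm_one_eq_lintegral_enorm, ← ofReal_integral_norm_eq_lintegral_enorm hint]
    rfl
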